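/- Let $\Phi_0$ be a finite reduced irreducible (crystallographic) root system of rank $r$ in a real vector space $V$, with simple roots $\alpha_1,\dots,\alpha_r$ and highest root $\theta$. The affine real roots are the affine functions $\alpha+n\delta : x\mapsto \langle\alpha,x\rangle+n$ ($\alpha\in\Phi_0$, $n\in\mathbb Z$, $\delta$ the constant function $1$); such a root is positive if $n\ge 0$ and $\alpha$ is positive, or $n\ge 1$ and $\alpha$ is negative, and $\Phi^+_{\mathrm{re}}$ denotes the set of positive affine real roots. Put $\alpha_0=-\theta+\delta$, and assume that the affine root system is simply laced, i.e. the off-diagonal entries of the affine Cartan matrix $(\langle\alpha_i,\alpha_j^\vee\rangle)_{0\le i,j\le r}$ are $0$ or $-1$; write $i\sim j$ if $i\ne j$ and the entry is $-1$. The affine Weyl group $W$ is generated by all reflections $x\mapsto x-(\langle\alpha,x\rangle+n)\alpha^\vee$; let $\sigma_i$ be the reflection in $\alpha_i$ ($0\le i\le r$). For $\beta=\sum_i k_i\alpha_i$ with $k_i\in\mathbb Z$ put $\mathbf x^\beta=\prod_{i=0}^r x_i^{k_i}$. Define $(\sigma_i\mathbf x)_j$ to be $1/x_j$ if $j=i$,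 $x_ix_j$ if $j\sim i$, and $x_j$ otherwise; $(\varepsilon_i\mathbf x)_j$ to be $-x_j$ if $j\sim i$ and $x_j$ otherwise; and $J(x,\epsilon)=\frac x2\left(\frac{u-x}{1-ux}-(-1)^\epsilon\right)$ for $\epsilon\in\{0,1\}$. The formula $$f|\sigma_i(\mathbf x;u)=f(\sigma_i\mathbf x;u)\,J(x_i,0)+f(\varepsilon_i\sigma_i\mathbf x;u)\,J(x_i,1)$$ extends to a well-defined right action $f\mapsto f|w$ of $W$ (the Chinta--Gunnells action) on the field $\mathbb C(x_0,\dots,x_r,u)$ of rational functions. Let $\Omega$ be the set of $(\mathbf x,u)\in\mathbb C^{r+1}\times\mathbb C$ with $|\mathbf x^\delta|<1$ and $u\mathbf x^\beta\ne\pm1$ for all $\beta\in\Phi^+_{\mathrm{re}}$. Then each rational function $1|w$ ($w\in W$) is regular on $\Omega$, and the series $$Z_W(\mathbf x;u)=\sum_{w\in W}1|w(\mathbf x;u)$$ converges absolutely at every point of $\Omega$, and absolutely and uniformly on every compact subset of $\Omega$. Moreover $Z_W$ is $W$-invariant under the Chinta--Gunnells action, given on functions of the complex variables $(\mathbf x,u)$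 by the same formula: $Z_W|\sigma_i=Z_W$ at every point $(\mathbf x,u)\in\Omega$ with $x_i\ne0$ and $(\sigma_i\mathbf x,u)\in\Omega$; and for every $w\in W$ and every expression $w=\sigma_{i_1}\cdots\sigma_{i_\ell}$ one has $Z_W|\sigma_{i_1}|\cdots|\sigma_{i_\ell}=Z_W$ at all points with every $x_i\ne 0$, $|\mathbf x^\delta|<1$ and $u\mathbf x^\beta\ne\pm1$ for all affine real roots $\beta$, positive or negative. -/

import Mathlib

noncomputable section

namespace ChintaGunnells

/-! ### Affine root data attached to a finite root system

`P` is a finite root system over `ℝ` with root space `M` and coroot space `N` (the affine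
reflections act on `N`, the roots being linear functions on `N`), `b` a base of `P`
(the simple roots) and `θ` the index of the highest root. -/

section AffineRoots

variable {ι M N : Type*} [AddCommGroup M] [Module ℝ M] [AddCommGroup N] [Module ℝ N]
  {P : RootPairing ι ℝ M N}

/-- `θ` is the highest root: `θ - α` is a nonnegative integral combination of simple roots
for every root `α`. -/
def IsHighestRoot (b : P.Base) (θ : ι) : Prop :=
  ∀ k : ι, P.root θ - P.root k ∈ AddSubmonoid.closure (P.root '' b.support)

/-- The nodes of the affine Dynkin diagram: `none` is the affine node `0`, and the nodes `some i`
correspond to the simple roots of the finite root system. -/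
abbrev Node (b : P.Base) : Type _ := Option b.support

/-- An affine real root `α + n δ` is represented by the pair `(k, n)` with `α = P.root k`. -/
abbrev AffineRealRoot (ι : Type*) : Type _ := ι × ℤ

/-- The affine function `α + n δ` on `N`, that is `x ↦ ⟨α, x⟩ + n`. -/
def affineFunction (P : RootPairing ι ℝ M N) (β : AffineRealRoot ι) (x : N) : ℝ :=
  P.toLinearMap (P.root β.1) x + β.2

/-- The affine simple roots: `α₀ = -θ + δ` and `αᵢ = αᵢ + 0 δ`. -/
def simpleRoot (b : P.Base) (θ : ι) : Node b → AffineRealRoot ι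
  | none => (P.reflectionPerm θ θ, 1)
  | some i => (i, 0)

/-- The integer coefficients of a root of the finite system on the simple roots. -/
def finiteCoeff (b : P.Base) (k : ι) (i : b.support) : ℤ :=
  b.toWeightBasisInt.repr (P.rootSpanMem ℤ k) i

/-- The coefficients of `δ = α₀ + θ` on the affine simple roots. -/
def deltaCoeff (b : P.Base) (θ : ι) : Node b → ℤ
  | none => 1
  | some i => finiteCoeff b θ i

/-- The coefficients of `α + n δ` on the affine simple roots. -/
def rootCoeff (b : P.Base) (θ : ι) (β : AffineRealRoot ι) : Node b → ℤ
  | none => β.2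
  | some i => finiteCoeff b β.1 i + β.2 * finiteCoeff b θ i

theorem root_eq_sum_finiteCoeff (b : P.Base) (k : ι) :
    P.root k = ∑ i : b.support, finiteCoeff b k i • P.root i := by
  have h := congrArg (Subtype.val) (b.toWeightBasisInt.sum_repr (P.rootSpanMem ℤ k))
  simpa [finiteCoeff] using h.symm

/-- `deltaCoeff` are the coefficients of the constant function `δ = 1` on the affine simple
roots. -/
theorem sum_deltaCoeff (b : P.Base) (θ : ι) (x : N) :
    ∑ i, (deltaCoeff b θ i : ℝ) * affineFunction P (simpleRoot b θ i) x = 1 := by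
  have h := congrArg (fun m ↦ P.toLinearMap m x) (root_eq_sum_finiteCoeff b θ)
  simp only [map_sum, map_zsmul, LinearMap.sum_apply, LinearMap.smul_apply, zsmul_eq_mul] at h
  simp only [Fintype.sum_option, deltaCoeff, affineFunction, simpleRoot,
    RootPairing.root_reflectionPerm, RootPairing.reflection_apply_self, map_neg,
    LinearMap.neg_apply, Int.cast_one, Int.cast_zero, add_zero, one_mul]
  rw [h]
  ring

/-- `rootCoeff` are the coefficients of `α + n δ` on the affine simple roots. -/
theorem sum_rootCoeff (b : P.Base) (θ : ι) (β : AffineRealRoot ι) (x : N) :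
    ∑ i, (rootCoeff b θ β i : ℝ) * affineFunction P (simpleRoot b θ i) x =
      affineFunction P β x := by
  have h := congrArg (fun m ↦ P.toLinearMap m x) (root_eq_sum_finiteCoeff b θ)
  have h' := congrArg (fun m ↦ P.toLinearMap m x) (root_eq_sum_finiteCoeff b β.1)
  simp only [map_sum, map_zsmul, LinearMap.sum_apply, LinearMap.smul_apply, zsmul_eq_mul] at h h'
  simp only [Fintype.sum_option, rootCoeff, affineFunction, simpleRoot,
    RootPairing.root_reflectionPerm, RootPairing.reflection_apply_self, map_neg,
    LinearMap.neg_apply, Int.cast_one, Int.cast_zero, add_zero, Int.cast_add, Int.cast_mul,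
    add_mul, Finset.sum_add_distrib, mul_assoc, ← Finset.mul_sum]
  rw [h, h']
  ring

open Classical in
/-- The positive affine real roots: `α + (n + χ(α)) δ` with `n ∈ ℕ`, where `χ` is the
characteristic function of the negative roots of the finite system. -/
def IsPositive (b : P.Base) (β : AffineRealRoot ι) : Prop :=
  (if b.IsPos β.1 then 0 else 1) ≤ β.2

/-- The affine Cartan matrix. -/
def affineCartan [P.IsCrystallographic] (b : P.Base) (θ : ι) : Matrix (Node b) (Node b) ℤ :=
  .of fun i j ↦ P.pairingIn ℤ (simpleRoot b θ i).1 (simpleRoot b θ j).1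

/-- The affine Dynkin diagram as a graph: distinct nodes are joined when the corresponding
entry of the Cartan matrix does not vanish. -/
def dynkin [P.IsCrystallographic] (b : P.Base) (θ : ι) : SimpleGraph (Node b) :=
  SimpleGraph.fromRel fun i j ↦ affineCartan b θ i j ≠ 0

/-- The reflection `x ↦ x - (⟨α, x⟩ + n) α^∨` of `N` attached to `α + n δ`. -/
def affineReflection (P : RootPairing ι ℝ M N) (β : AffineRealRoot ι) : N ≃ᵃ[ℝ] N :=
  (P.coreflection β.1).toAffineEquiv.trans
    (AffineEquiv.constVAdd ℝ N (-((β.2 : ℝ) • P.coroot β.1)))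

theorem affineReflection_apply (β : AffineRealRoot ι) (x : N) :
    affineReflection P β x = x - affineFunction P β x • P.coroot β.1 := by
  simp [affineReflection, affineFunction, RootPairing.coreflection_apply, add_smul,
    RootPairing.root']
  abel

/-- The affine Weyl group: the group of affine transformations of `N` generated by the
reflections in all affine real roots. -/
def affineWeylGroup (P : RootPairing ι ℝ M N) : Subgroup (N ≃ᵃ[ℝ] N) :=
  Subgroup.closure (Set.range (affineReflection P))

/-- The simple reflections, as elements of the affine Weyl group. -/
def simpleReflection (b : P.Base) (θ : ι) (i : Node b) : affineWeylGroup P :=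
  ⟨affineReflection P (simpleRoot b θ i), Subgroup.subset_closure ⟨_, rfl⟩⟩

/-- The product `σ_{i₁} ⋯ σ_{iₗ}` of the simple reflections in a word. -/
def wordProd (b : P.Base) (θ : ι) (l : List (Node b)) : affineWeylGroup P :=
  (l.map (simpleReflection b θ)).prod

end AffineRoots

/-! ### The Chinta-Gunnells action attached to a simply laced diagram -/

section Action

variable {I : Type*}

/-- The monomial `∏ᵢ xᵢ ^ cᵢ`. -/
def monomial {F : Type*} [Field F] [Fintype I] (x : I → F) (c : I → ℤ) : F :=
  ∏ i, x i ^ c i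

open Classical in
/-- The simple reflection on the variables: `(σᵢ x)ⱼ` is `1 / xⱼ` for `j = i`, `xᵢ xⱼ` for
`j ∼ i`, and `xⱼ` otherwise. -/
def reflectVars {F : Type*} [Field F] (G : SimpleGraph I) (i : I) (x : I → F) : I → F :=
  fun j ↦ if j = i then (x j)⁻¹ else if G.Adj j i then x i * x j else x j

open Classical in
/-- The sign change on the variables: `(εᵢ x)ⱼ` is `-xⱼ` for `j ∼ i`, and `xⱼ` otherwise. -/
def signVars {F : Type*} [Field F] (G : SimpleGraph I) (i : I) (x : I → F) : I → F :=
  fun j ↦ if G.Adj j i then -x j else x j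

/-- `J(x, u, ε) = (x / 2) ((u - x) / (1 - u x) - (-1) ^ ε)`. -/
def J {F : Type*} [Field F] (x u : F) (ε : ℕ) : F :=
  x / 2 * ((u - x) / (1 - u * x) - (-1) ^ ε)

/-- The polynomial ring in the variables `xᵢ` (`Sum.inl i`) and `u` (`Sum.inr ()`). -/
abbrev Poly (I : Type*) : Type _ := MvPolynomial (I ⊕ Unit) ℂ

/-- The field `ℂ(x, u)` of rational functions. -/
abbrev RatFun (I : Type*) : Type _ := FractionRing (Poly I)

/-- The generator `xᵢ` of `ℂ(x, u)`. -/
def varX (i : I) : RatFun I := algebraMap (Poly I) (RatFun I) (MvPolynomial.X (Sum.inl i))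

/-- The generator `u` of `ℂ(x, u)`. -/
def varU : RatFun I := algebraMap (Poly I) (RatFun I) (MvPolynomial.X (Sum.inr ()))

/-- The homomorphism `p ↦ p(y; u)` from polynomials to rational functions. -/
def substPoly (y : I → RatFun I) : Poly I →ₐ[ℂ] RatFun I :=
  MvPolynomial.aeval (Sum.elim y fun _ ↦ varU)

open Classical in
theorem substPoly_injective_aux (G : SimpleGraph I) (i : I) (s : ℤ) (hs : s * s = 1)
    (y : I → RatFun I)
    (hy : ∀ j, y j = if j = i then (varX j)⁻¹
      else if G.Adj j i then (s : RatFun I) * (varX i * varX j) else varX j) :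
    Function.Injective (substPoly y) := by
  let t : Poly I := MvPolynomial.X (Sum.inl i)
  have ht : t ≠ 0 := MvPolynomial.X_ne_zero _
  let A := Localization.Away t
  have hle : Submonoid.powers t ≤ nonZeroDivisors (Poly I) :=
    powers_le_nonZeroDivisors_of_noZeroDivisors ht
  have hAinj : Function.Injective (algebraMap (Poly I) A) := IsLocalization.injective A hle
  let a : I ⊕ Unit → A := fun v ↦ algebraMap (Poly I) A (MvPolynomial.X v)
  have hinv : a (Sum.inl i) * IsLocalization.Away.invSelf t = 1 :=
    IsLocalization.Away.mul_invSelf t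
  let y' : I → A := fun j ↦ if j = i then IsLocalization.Away.invSelf t
    else if G.Adj j i then (s : A) * (a (Sum.inl i) * a (Sum.inl j)) else a (Sum.inl j)
  let ψ : Poly I →ₐ[ℂ] A := MvPolynomial.aeval (Sum.elim y' fun _ ↦ a (Sum.inr ()))
  have hyi : y' i = IsLocalization.Away.invSelf t := if_pos rfl
  have hψX : ∀ j, ψ (MvPolynomial.X (Sum.inl j)) = y' j := fun j ↦ by simp [ψ]
  have hψU : ψ (MvPolynomial.X (Sum.inr ())) = a (Sum.inr ()) := by simp [ψ]
  have hψt : ψ t = IsLocalization.Away.invSelf t := by rw [← hyi, ← hψX i]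
  have hunit : IsUnit ((ψ : Poly I →+* A) t) := by
    refine IsUnit.of_mul_eq_one (a (Sum.inl i)) ?_
    rw [mul_comm]
    simpa [hψt] using hinv
  let ψ' : A →+* A := IsLocalization.Away.lift t hunit
  have hψ' : ∀ p, ψ' (algebraMap (Poly I) A p) = ψ p := fun p ↦
    IsLocalization.Away.lift_eq t hunit p
  have hψ'i : ψ' (IsLocalization.Away.invSelf t) = a (Sum.inl i) := by
    have h1 : ψ' (a (Sum.inl i)) * ψ' (IsLocalization.Away.invSelf t) = 1 := by
      rw [← map_mul, hinv, map_one]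
    have h2 : ψ' (a (Sum.inl i)) = IsLocalization.Away.invSelf t := by
      rw [show ψ' (a (Sum.inl i)) = ψ t from hψ' _, hψt]
    rw [h2] at h1
    calc ψ' (IsLocalization.Away.invSelf t)
        = (a (Sum.inl i) * IsLocalization.Away.invSelf t)
            * ψ' (IsLocalization.Away.invSelf t) := by rw [hinv, one_mul]
      _ = a (Sum.inl i) := by rw [mul_assoc, h1, mul_one]
  have hsA : (s : A) * (s : A) = 1 := by rw [← Int.cast_mul, hs, Int.cast_one]
  have hcomp : ψ'.comp (ψ : Poly I →+* A) = algebraMap (Poly I) A := by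
    apply MvPolynomial.ringHom_ext
    · intro c
      have h1 : ψ (MvPolynomial.C c) = algebraMap (Poly I) A (MvPolynomial.C c) := by
        simp [ψ, IsScalarTower.algebraMap_apply ℂ (Poly I) A]
      simp only [RingHom.comp_apply, RingHom.coe_coe]
      rw [h1, hψ', h1]
    · rintro (j | ⟨⟩)
      · simp only [RingHom.comp_apply, RingHom.coe_coe, hψX]
        change _ = a (Sum.inl j)
        by_cases hj : j = i
        · subst hj
          rw [hyi, hψ'i]
        · by_cases hG : G.Adj j i
          · have e1 : y' j = (s : A) * (a (Sum.inl i) * a (Sum.inl j)) := by simp [y', hj, hG]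
            have e2 : ψ' (a (Sum.inl j)) = y' j := by rw [← hψX]; exact hψ' _
            have e3 : ψ' (a (Sum.inl i)) = IsLocalization.Away.invSelf t := by
              rw [← hyi, ← hψX]; exact hψ' _
            rw [e1, map_mul, map_mul, map_intCast, e2, e3, e1]
            linear_combination (a (Sum.inl j)) * hsA +
              (s : A) * (s : A) * a (Sum.inl j) * hinv
          · have e1 : y' j = a (Sum.inl j) := by simp [y', hj, hG]
            have e2 : ψ' (a (Sum.inl j)) = y' j := by rw [← hψX]; exact hψ' _
            rw [e1, e2, e1]
      · simp only [RingHom.comp_apply, RingHom.coe_coe, hψU]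
        exact (hψ' _).trans hψU
  have hψinj : Function.Injective ψ := by
    have h : Function.Injective (ψ' ∘ ψ) := by
      have : (ψ' ∘ ψ) = algebraMap (Poly I) A := by
        rw [← hcomp]; rfl
      rw [this]; exact hAinj
    exact h.of_comp
  have hgu : ∀ z : Submonoid.powers t, IsUnit (algebraMap (Poly I) (RatFun I) z) := fun z ↦
    IsLocalization.map_units (RatFun I) (⟨z, hle z.2⟩ : nonZeroDivisors (Poly I))
  let g : A →+* RatFun I := IsLocalization.lift hgu
  have hg : ∀ p, g (algebraMap (Poly I) A p) = algebraMap (Poly I) (RatFun I) p := fun p ↦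
    IsLocalization.lift_eq hgu p
  have hginj : Function.Injective g := by
    rw [IsLocalization.lift_injective_iff]
    intro p q
    rw [hAinj.eq_iff, (IsFractionRing.injective (Poly I) (RatFun I)).eq_iff]
  have hgi : g (IsLocalization.Away.invSelf t) = (varX i)⁻¹ := by
    refine eq_inv_of_mul_eq_one_right ?_
    have := congrArg g hinv
    rw [map_mul, map_one] at this
    rw [← this]
    congr 1
    exact (hg _).symm
  have hfin : (substPoly y : Poly I →+* RatFun I) = g.comp (ψ : Poly I →+* A) := by
    apply MvPolynomial.ringHom_ext
    · intro c
      have h1 : ψ (MvPolynomial.C c) = algebraMap (Poly I) A (MvPolynomial.C c) := by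
        simp [ψ, IsScalarTower.algebraMap_apply ℂ (Poly I) A]
      simp only [RingHom.comp_apply, RingHom.coe_coe]
      rw [h1, hg]
      simp [substPoly, IsScalarTower.algebraMap_apply ℂ (Poly I) (RatFun I)]
    · rintro (j | ⟨⟩)
      · simp only [RingHom.comp_apply, RingHom.coe_coe, hψX]
        have e0 : substPoly y (MvPolynomial.X (Sum.inl j)) = y j := by simp [substPoly]
        have e4 : ∀ k, g (a (Sum.inl k)) = varX k := fun k ↦ hg _
        rw [e0, hy]
        by_cases hj : j = i
        · subst hj
          simp [hyi, hgi]
        · by_cases hG : G.Adj j i <;> simp [y', hj, hG, e4, map_intCast g s]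
      · simp only [RingHom.comp_apply, RingHom.coe_coe, hψU]
        have e0 : substPoly y (MvPolynomial.X (Sum.inr ())) = varU := by simp [substPoly]
        rw [e0]
        exact (hg _).symm
  intro p q hpq
  apply hψinj
  apply hginj
  have h1 := RingHom.congr_fun hfin p
  have h2 := RingHom.congr_fun hfin q
  simp only [RingHom.comp_apply, RingHom.coe_coe] at h1 h2
  rw [← h1, ← h2, hpq]

theorem substPoly_reflectVars_injective (G : SimpleGraph I) (i : I) :
    Function.Injective (substPoly (reflectVars G i (varX (I := I)))) :=
  substPoly_injective_aux G i 1 (by norm_num) _ fun j ↦ by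
    simp [reflectVars]

theorem substPoly_signVars_reflectVars_injective (G : SimpleGraph I) (i : I) :
    Function.Injective (substPoly (signVars G i (reflectVars G i (varX (I := I))))) :=
  substPoly_injective_aux G i (-1) (by norm_num) _ fun j ↦ by
    by_cases hj : j = i
    · subst hj
      simp [reflectVars, signVars]
    · by_cases hG : G.Adj j i <;> simp [reflectVars, signVars, hj, hG]

/-- The substitution `f ↦ f(σᵢ x; u)` on rational functions. -/
def substReflect (G : SimpleGraph I) (i : I) : RatFun I →+* RatFun I :=
  IsFractionRing.lift (A := Poly I)
    (g := (substPoly (reflectVars G i (varX (I := I))) : Poly I →+* RatFun I))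
    (substPoly_reflectVars_injective G i)

/-- The substitution `f ↦ f(εᵢ σᵢ x; u)` on rational functions. -/
def substSignReflect (G : SimpleGraph I) (i : I) : RatFun I →+* RatFun I :=
  IsFractionRing.lift (A := Poly I)
    (g := (substPoly (signVars G i (reflectVars G i (varX (I := I)))) : Poly I →+* RatFun I))
    (substPoly_signVars_reflectVars_injective G i)

/-- The action `f|σᵢ` of a simple reflection on a rational function. -/
def slashSimple (G : SimpleGraph I) (i : I) (f : RatFun I) : RatFun I :=
  substReflect G i f * J (varX i) varU 0 + substSignReflect G i f * J (varX i) varU 1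

/-- `f|σ_{i₁}|σ_{i₂}|⋯|σ_{iₗ}` for a rational function `f`. -/
def slashWord (G : SimpleGraph I) (l : List I) (f : RatFun I) : RatFun I :=
  l.foldl (fun g i ↦ slashSimple G i g) f

/-- Points `(x; u)` with `x = (xᵢ)`. -/
abbrev Point (I : Type*) : Type _ := (I → ℂ) × ℂ

/-- A rational function is regular at a point if its denominator in lowest terms does not vanish
there. -/
def IsRegularAt (f : RatFun I) (z : Point I) : Prop :=
  MvPolynomial.eval (Sum.elim z.1 fun _ ↦ z.2) (IsFractionRing.den (Poly I) f : Poly I) ≠ 0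

/-- The value of a rational function at a point (meaningful where it is regular). -/
def value (f : RatFun I) (z : Point I) : ℂ :=
  MvPolynomial.eval (Sum.elim z.1 fun _ ↦ z.2) (IsFractionRing.num (Poly I) f) /
    MvPolynomial.eval (Sum.elim z.1 fun _ ↦ z.2) (IsFractionRing.den (Poly I) f : Poly I)

/-- The action `F|σᵢ` of a simple reflection on a function of the complex variables `(x; u)`. -/
def slashFun (G : SimpleGraph I) (i : I) (F : Point I → ℂ) (z : Point I) : ℂ :=
  F (reflectVars G i z.1, z.2) * J (z.1 i) z.2 0 +
    F (signVars G i (reflectVars G i z.1), z.2) * J (z.1 i) z.2 1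

/-- `F|σ_{i₁}|σ_{i₂}|⋯|σ_{iₗ}` for a function `F` of the complex variables `(x; u)`. -/
def slashFunWord (G : SimpleGraph I) (l : List I) (F : Point I → ℂ) : Point I → ℂ :=
  l.foldl (fun g i ↦ slashFun G i g) F

end Action

/-! ### The average over the affine Weyl group -/

section Average

variable {ι M N : Type*} [AddCommGroup M] [Module ℝ M] [AddCommGroup N] [Module ℝ N]
  {P : RootPairing ι ℝ M N} [P.IsCrystallographic]

open Classical in
/-- The action `f|w` of an element of the affine Weyl group on a rational function, computed from
an expression of `w` as a product of simple reflections. -/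
def slash (b : P.Base) (θ : ι) (w : affineWeylGroup P) (f : RatFun (Node b)) : RatFun (Node b) :=
  if h : ∃ l, wordProd b θ l = w then slashWord (dynkin b θ) h.choose f else 0

/-- The terms `1|w (x; u)` of the average. -/
def term (b : P.Base) (θ : ι) (w : affineWeylGroup P) (z : Point (Node b)) : ℂ :=
  value (slash b θ w 1) z

/-- The average `Z_W(x; u) = ∑_w 1|w (x; u)`. -/
def ZW (b : P.Base) (θ : ι) (z : Point (Node b)) : ℂ :=
  ∑' w : affineWeylGroup P, term b θ w z

/-- The points `(x; u)` with `|x^δ| < 1` and `u x^β ≠ ±1` for all positive affine real roots. -/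
def region (b : P.Base) (θ : ι) : Set (Point (Node b)) :=
  {z | ‖monomial z.1 (deltaCoeff b θ)‖ < 1 ∧
    ∀ β : AffineRealRoot ι, IsPositive b β →
      z.2 * monomial z.1 (rootCoeff b θ β) ≠ 1 ∧ z.2 * monomial z.1 (rootCoeff b θ β) ≠ -1}

/-- The points `(x; u)` with all `xᵢ ≠ 0`, `|x^δ| < 1` and `u x^β ≠ ±1` for all affine real
roots, positive or negative. -/
def stableRegion (b : P.Base) (θ : ι) : Set (Point (Node b)) :=
  {z | (∀ i, z.1 i ≠ 0) ∧ ‖monomial z.1 (deltaCoeff b θ)‖ < 1 ∧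
    ∀ β : AffineRealRoot ι,
      z.2 * monomial z.1 (rootCoeff b θ β) ≠ 1 ∧ z.2 * monomial z.1 (rootCoeff b θ β) ≠ -1}

end Average

end ChintaGunnells

end

noncomputable section

namespace ChintaGunnells

/-! ### Affine real roots and their reflections. -/

section AffineRootCombinatorics

variable {ι M N : Type*} [AddCommGroup M] [Module ℝ M] [AddCommGroup N] [Module ℝ N]
  {P : RootPairing ι ℝ M N}

/-! One application of `σ_i` to a rational function produces two terms, each with a new factor
`J(x_i, u, ε)`, and turns every monomial `x^β` into `± x^{σ_i β}`. Building up a reduced word, `1|w`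
therefore becomes a sum of `2^#S` products of factors `J(± x^β, u, ε)`, one factor for each `β` in
the inversion set `S` of `w`, the positive real roots that `w` makes negative
(`exists_isInversionSet_isJSum`). Positive roots have nonnegative coefficients, so poles can occur
only where `u x^β = ±1`; this gives regularity on `Ω`.

For convergence, `J(x, u, ε)` has a factor `x`, and `x^β = x^{β₀} (x^δ)^m` with `β₀` in a finite
set. Hence on a compact subset of `Ω` the factors are bounded by constants `a_β` with `∑ a_β < ∞`
(`exists_norm_J_le`). An element `w` is determined by its inversion set (`IsInversionSet.unique`),
so the sum over `w` of the bounds is at most the sum of `∏_{β ∈ S} 2 a_β` over all finite sets `S`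
of roots, that is `∏ (1 + 2 a_β) < ∞`. The Weierstrass test applies, and invariance is the
reindexing `w ↦ w σ_i` of an absolutely convergent series (`slashFun_ZW`).

Two algebraic facts support this. First, `W` is the Coxeter group of its diagram. The group
presented by the diagram acts on the real roots, and lengthening `w` by `σ_i` on the right is
equivalent to `w α_i > 0` (`isPositive_rootAction_iff`). So a nontrivial element makes some simple
root negative and cannot act trivially; surjectivity onto `W` is induction on the height of a root
(`affineReflection_mem_closure`). Second, the operators `f ↦ f|σ_i` satisfy the Coxeter relations
(`slashSimple_slashSimple_self`, `slashSimple_comm`, `slashSimple_braid`), which comes down to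
identities between values of `J`. Together they make `f|w` independent of the word for `w`. -/

theorem affineFunction_injective : Function.Injective (affineFunction P) := by
  rintro ⟨k, n⟩ ⟨k', n'⟩ h
  have hn : n = n' := by
    have := congrFun h 0
    simpa [affineFunction] using this
  subst hn
  have hk : P.toLinearMap (P.root k) = P.toLinearMap (P.root k') := by
    ext x
    have := congrFun h x
    simpa [affineFunction] using this
  have := P.root.injective (P.toPerfPair.injective hk)
  rw [this]

theorem affineReflection_involutive (γ : AffineRealRoot ι) (x : N) :
    affineReflection P γ (affineReflection P γ x) = x := by
  have h : affineFunction P γ (x - affineFunction P γ x • P.coroot γ.1) =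
      - affineFunction P γ x := by
    simp only [affineFunction, map_sub, map_smul, RootPairing.root_coroot_eq_pairing,
      RootPairing.pairing_same, smul_eq_mul]
    ring
  rw [affineReflection_apply, affineReflection_apply, h]
  simp

theorem affineReflection_mul_self (γ : AffineRealRoot ι) :
    affineReflection P γ * affineReflection P γ = 1 := by
  ext x
  exact affineReflection_involutive γ x

/-- The negative of an affine real root. -/
def negAffine (P : RootPairing ι ℝ M N) (β : AffineRealRoot ι) : AffineRealRoot ι :=
  (P.reflectionPerm β.1 β.1, -β.2)

section Crystallographic

variable [P.IsCrystallographic]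

/-- The reflection of the affine real root `β` in the affine real root `γ`. -/
def reflectAffine (P : RootPairing ι ℝ M N) [P.IsCrystallographic] (γ β : AffineRealRoot ι) :
    AffineRealRoot ι :=
  (P.reflectionPerm γ.1 β.1, β.2 - P.pairingIn ℤ β.1 γ.1 * γ.2)

theorem cast_pairingIn (k l : ι) : ((P.pairingIn ℤ k l : ℤ) : ℝ) = P.pairing k l :=
  P.algebraMap_pairingIn ℤ k l

theorem root_reflectAffine (γ β : AffineRealRoot ι) :
    P.root (reflectAffine P γ β).1 = P.root β.1 - P.pairingIn ℤ β.1 γ.1 • P.root γ.1 := by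
  rw [reflectAffine, RootPairing.root_reflectionPerm, RootPairing.reflection_apply_root,
    ← cast_pairingIn, Int.cast_smul_eq_zsmul]

theorem affineFunction_reflectAffine (γ β : AffineRealRoot ι) (x : N) :
    affineFunction P (reflectAffine P γ β) x = affineFunction P β (affineReflection P γ x) := by
  rw [affineReflection_apply, affineFunction, root_reflectAffine]
  simp only [affineFunction, reflectAffine, map_sub, map_zsmul, LinearMap.sub_apply,
    LinearMap.smul_apply, map_smul, RootPairing.root_coroot_eq_pairing, ← cast_pairingIn,
    smul_eq_mul, zsmul_eq_mul]
  push_cast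
  ring

theorem reflectAffine_involutive (γ β : AffineRealRoot ι) :
    reflectAffine P γ (reflectAffine P γ β) = β := by
  apply affineFunction_injective (P := P)
  ext x
  rw [affineFunction_reflectAffine, affineFunction_reflectAffine, affineReflection_involutive]

/-- This conjugation formula lets the reflection in a root be obtained from the reflection in a
lower root. -/
theorem affineReflection_reflectAffine (γ β : AffineRealRoot ι) :
    affineReflection P (reflectAffine P γ β) =
      affineReflection P γ * affineReflection P β * affineReflection P γ := by
  ext x
  simp only [AffineEquiv.coe_mul, Function.comp_apply]
  rw [affineReflection_apply (reflectAffine P γ β), affineFunction_reflectAffine]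
  set y := affineReflection P γ x with hy
  have hx : x = affineReflection P γ y := (affineReflection_involutive γ x).symm
  rw [hx, affineReflection_apply β, affineReflection_apply γ, affineReflection_apply γ,
    reflectAffine, RootPairing.coroot_reflectionPerm, RootPairing.coreflection_apply]
  have h : affineFunction P γ (y - affineFunction P β y • P.coroot β.1) =
      affineFunction P γ y - affineFunction P β y * P.pairing γ.1 β.1 := by
    simp only [affineFunction, map_sub, map_smul, RootPairing.root_coroot_eq_pairing, smul_eq_mul]
    ring
  rw [h, RootPairing.root'_coroot_eq_pairing]
  module

theorem reflectAffine_self (β : AffineRealRoot ι) : reflectAffine P β β = negAffine P β := by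
  rw [reflectAffine, negAffine]
  simp
  ring

theorem affineReflection_negAffine (β : AffineRealRoot ι) :
    affineReflection P (negAffine P β) = affineReflection P β := by
  rw [← reflectAffine_self, affineReflection_reflectAffine, affineReflection_mul_self, one_mul]

end Crystallographic

/-! ### Coefficients on the affine simple roots, positivity and height. -/

section Coefficients

open scoped Classical

variable (b : P.Base) (θ : ι)

theorem finiteCoeff_eq {k : ι} {c : b.support → ℤ} (h : P.root k = ∑ i, c i • P.root i)
    (i : b.support) : finiteCoeff b k i = c i := by
  have h' : P.rootSpanMem ℤ k = ∑ i, c i • b.toWeightBasisInt i := by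
    apply Subtype.ext
    simpa using h
  rw [finiteCoeff, h', Module.Basis.repr_sum_self]

theorem finiteCoeff_eq_single (i : b.support) : finiteCoeff b i = Pi.single i 1 := by
  ext j
  refine finiteCoeff_eq b ?_ j
  rw [Finset.sum_eq_single i (fun j _ hj ↦ by simp [hj]) (by simp)]
  simp

theorem exists_natCoeff {m : M} (hm : m ∈ AddSubmonoid.closure (P.root '' b.support)) :
    ∃ c : b.support → ℕ, m = ∑ i, (c i : ℤ) • P.root i := by
  induction hm using AddSubmonoid.closure_induction with
  | mem x hx =>
    obtain ⟨k, hk, rfl⟩ := hx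
    refine ⟨Pi.single ⟨k, hk⟩ 1, ?_⟩
    rw [Finset.sum_eq_single ⟨k, hk⟩ (fun j _ hj ↦ by simp [hj]) (by simp)]
    simp
  | zero => exact ⟨0, by simp⟩
  | add x y _ _ hx hy =>
    obtain ⟨c, rfl⟩ := hx
    obtain ⟨d, rfl⟩ := hy
    exact ⟨c + d, by simp [add_smul, Finset.sum_add_distrib]⟩

theorem height_eq_sum_finiteCoeff (k : ι) : b.height k = ∑ i, finiteCoeff b k i := by
  let f : ι → ℤ := fun j ↦ if h : j ∈ b.support then finiteCoeff b k ⟨j, h⟩ else 0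
  have hf : ∀ j : b.support, f j = finiteCoeff b k j := fun j ↦ dif_pos j.2
  rw [RootPairing.Base.height_eq_sum (f := f), ← Finset.sum_coe_sort]
  · exact Finset.sum_congr rfl fun j _ ↦ hf j
  · rw [root_eq_sum_finiteCoeff b k, ← Finset.sum_coe_sort b.support fun j ↦ f j • P.root j]
    exact Finset.sum_congr rfl fun j _ ↦ by rw [hf]

theorem finiteCoeff_nonneg {k : ι} (hk : b.IsPos k) (i : b.support) : 0 ≤ finiteCoeff b k i := by
  rcases b.root_mem_or_neg_mem k with h | h
  · obtain ⟨c, hc⟩ := exists_natCoeff b h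
    rw [finiteCoeff_eq b hc]
    positivity
  · obtain ⟨c, hc⟩ := exists_natCoeff b h
    have hc' : ∀ i, finiteCoeff b k i = -(c i : ℤ) := finiteCoeff_eq b (by
      rw [neg_eq_iff_eq_neg.mp hc]; simp)
    rw [RootPairing.Base.IsPos, height_eq_sum_finiteCoeff] at hk
    have : ∑ i, finiteCoeff b k i ≤ 0 := Finset.sum_nonpos fun i _ ↦ by rw [hc']; simp
    omega

variable {b θ}

theorem IsHighestRoot.finiteCoeff_le (hθ : IsHighestRoot b θ) (k : ι) (i : b.support) :
    finiteCoeff b k i ≤ finiteCoeff b θ i := by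
  obtain ⟨c, hc⟩ := exists_natCoeff b (hθ k)
  have : finiteCoeff b θ i = finiteCoeff b k i + c i := by
    refine finiteCoeff_eq b (c := fun i ↦ finiteCoeff b k i + c i) ?_ i
    simp only [add_smul, Finset.sum_add_distrib]
    rw [← root_eq_sum_finiteCoeff, ← hc]
    abel
  omega

theorem finiteCoeff_reflectionPerm_self (k : ι) (i : b.support) :
    finiteCoeff b (P.reflectionPerm k k) i = -finiteCoeff b k i :=
  finiteCoeff_eq b (c := fun i ↦ -finiteCoeff b k i) (by
    rw [RootPairing.root_reflectionPerm, RootPairing.reflection_apply_self,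
      root_eq_sum_finiteCoeff b k]
    simp) i

theorem IsHighestRoot.neg_finiteCoeff_le (hθ : IsHighestRoot b θ) (k : ι) (i : b.support) :
    -finiteCoeff b k i ≤ finiteCoeff b θ i :=
  (finiteCoeff_reflectionPerm_self k i).symm.trans_le (hθ.finiteCoeff_le _ i)

theorem IsHighestRoot.finiteCoeff_nonneg (hθ : IsHighestRoot b θ) (i : b.support) :
    0 ≤ finiteCoeff b θ i := by
  linarith [hθ.neg_finiteCoeff_le θ i]

theorem deltaCoeff_nonneg (hθ : IsHighestRoot b θ) : 0 ≤ deltaCoeff b θ := by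
  rintro (_ | i)
  · exact zero_le_one
  · exact hθ.finiteCoeff_nonneg i

/-- Only a negative `α` needs an argument: then `n ≥ 1`, and no coefficient of `-α` exceeds the
corresponding one of `θ`, so `n θ` compensates for `α`. -/
theorem rootCoeff_nonneg (hθ : IsHighestRoot b θ) {β : AffineRealRoot ι} (hβ : IsPositive b β) :
    0 ≤ rootCoeff b θ β := by
  obtain ⟨k, n⟩ := β
  unfold IsPositive at hβ
  split_ifs at hβ with hk
  · rintro (_ | i)
    · exact hβ
    · exact add_nonneg (finiteCoeff_nonneg b hk i) (mul_nonneg hβ (hθ.finiteCoeff_nonneg i))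
  · rintro (_ | i)
    · exact zero_le_one.trans hβ
    · have h1 := hθ.neg_finiteCoeff_le k i
      have h2 := hθ.finiteCoeff_nonneg i
      simp only [rootCoeff, Pi.zero_apply]
      dsimp only at hβ
      nlinarith

theorem rootCoeff_negAffine (β : AffineRealRoot ι) :
    rootCoeff b θ (negAffine P β) = -rootCoeff b θ β := by
  ext (_ | i)
  · rfl
  · simp only [rootCoeff, negAffine, finiteCoeff_reflectionPerm_self, Pi.neg_apply]
    ring

theorem isPositive_negAffine (β : AffineRealRoot ι) :
    IsPositive b (negAffine P β) ↔ ¬ IsPositive b β := by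
  have h := RootPairing.Base.IsPos.neg_iff_not b β.1
  have h' : b.IsPos (P.reflectionPerm β.1 β.1) ↔ ¬ b.IsPos β.1 := h
  by_cases hk : b.IsPos β.1
  · simp only [IsPositive, negAffine, h', hk, not_true_eq_false, if_true, if_false]
    omega
  · simp only [IsPositive, negAffine, h', hk, not_false_eq_true, if_true, if_false]
    omega

theorem rootCoeff_nonpos (hθ : IsHighestRoot b θ) {β : AffineRealRoot ι}
    (hβ : ¬ IsPositive b β) : rootCoeff b θ β ≤ 0 := by
  have := rootCoeff_nonneg hθ ((isPositive_negAffine β).mpr hβ)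
  rwa [rootCoeff_negAffine, le_neg, neg_zero] at this

theorem root_eq_sum_rootCoeff (β : AffineRealRoot ι) :
    P.root β.1 = ∑ i, rootCoeff b θ β i • P.root (simpleRoot b θ i).1 := by
  simp only [Fintype.sum_option, rootCoeff, simpleRoot, RootPairing.root_reflectionPerm,
    RootPairing.reflection_apply_self, add_smul, Finset.sum_add_distrib, mul_smul,
    ← Finset.smul_sum, ← root_eq_sum_finiteCoeff]
  simp

theorem rootCoeff_injective : Function.Injective (rootCoeff b θ) := by
  intro β β' h
  apply affineFunction_injective (P := P)
  ext x
  rw [← sum_rootCoeff b θ, ← sum_rootCoeff b θ, h]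

theorem rootCoeff_ne_zero (β : AffineRealRoot ι) : rootCoeff b θ β ≠ 0 := by
  intro h
  have := root_eq_sum_rootCoeff (b := b) (θ := θ) β
  rw [h] at this
  exact P.ne_zero β.1 (by simpa using this)

theorem isPositive_iff (hθ : IsHighestRoot b θ) {β : AffineRealRoot ι} :
    IsPositive b β ↔ 0 ≤ rootCoeff b θ β := by
  refine ⟨rootCoeff_nonneg hθ, fun h ↦ ?_⟩
  by_contra hβ
  exact rootCoeff_ne_zero β (le_antisymm (rootCoeff_nonpos hθ hβ) h)

/-- The coefficients of a real root all have one sign, so a single positive coefficient decides. -/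
theorem isPositive_of_pos (hθ : IsHighestRoot b θ) {β : AffineRealRoot ι} {i : Node b}
    (h : 0 < rootCoeff b θ β i) : IsPositive b β := by
  by_contra hβ
  exact absurd (rootCoeff_nonpos hθ hβ i) (not_le.mpr h)

theorem rootCoeff_simpleRoot (i : Node b) :
    rootCoeff b θ (simpleRoot b θ i) = Pi.single i 1 := by
  ext (_ | j) <;> rcases i with _ | i
  · simp [rootCoeff, simpleRoot]
  · simp [rootCoeff, simpleRoot]
  · simp [rootCoeff, simpleRoot, finiteCoeff_reflectionPerm_self]
  · simp [rootCoeff, simpleRoot, finiteCoeff_eq_single, Pi.single_apply]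

theorem isPositive_simpleRoot (hθ : IsHighestRoot b θ) (i : Node b) :
    IsPositive b (simpleRoot b θ i) :=
  isPositive_of_pos hθ (i := i) (by simp [rootCoeff_simpleRoot])

/-- The gradient of such a root is `c α_i`; reducedness leaves `c = ±1`, and positivity excludes
`-1`. -/
theorem eq_simpleRoot_of_rootCoeff [P.IsReduced] (hθ : IsHighestRoot b θ) {β : AffineRealRoot ι}
    (hβ : IsPositive b β) {i : Node b} (h : ∀ j ≠ i, rootCoeff b θ β j = 0) :
    β = simpleRoot b θ i := by
  have hc : rootCoeff b θ β = rootCoeff b θ β i • Pi.single i 1 := by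
    ext j
    by_cases hj : j = i
    · subst hj; simp
    · simp [hj, h j hj]
  set c := rootCoeff b θ β i with hcdef
  have hc0 : 0 ≤ c := rootCoeff_nonneg hθ hβ i
  have hroot : P.root β.1 = c • P.root (simpleRoot b θ i).1 := by
    rw [root_eq_sum_rootCoeff (b := b) (θ := θ) β, Finset.sum_eq_single i
      (fun j _ hj ↦ by rw [h j hj, zero_smul]) (by simp)]
  have hlin : ¬ LinearIndependent ℝ ![P.root β.1, P.root (simpleRoot b θ i).1] := by
    rw [LinearIndependent.pair_iff]
    push Not
    refine ⟨1, -c, ?_, by simp⟩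
    rw [hroot, one_smul, neg_smul, Int.cast_smul_eq_zsmul, add_neg_cancel]
  have hne := P.ne_zero (simpleRoot b θ i).1
  have hinj : ∀ d : ℤ, c • P.root (simpleRoot b θ i).1 = d • P.root (simpleRoot b θ i).1 →
      c = d := fun d hd ↦ by
    rw [← Int.cast_smul_eq_zsmul ℝ, ← Int.cast_smul_eq_zsmul ℝ] at hd
    exact_mod_cast smul_left_injective ℝ hne hd
  have hc1 : c = 1 := by
    rcases RootPairing.IsReduced.eq_or_eq_neg _ _ hlin with h1 | h1
    · exact hinj 1 (by rw [← hroot, h1, one_smul])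
    · have := hinj (-1) (by rw [← hroot, h1, neg_smul, one_smul])
      omega
  apply rootCoeff_injective (b := b) (θ := θ)
  rw [rootCoeff_simpleRoot, hc, hc1, one_smul]

variable [P.IsCrystallographic]

theorem rootCoeff_reflectAffine (i : Node b) (β : AffineRealRoot ι) :
    rootCoeff b θ (reflectAffine P (simpleRoot b θ i) β) =
      rootCoeff b θ β - P.pairingIn ℤ β.1 (simpleRoot b θ i).1 • Pi.single i 1 := by
  set p := P.pairingIn ℤ β.1 (simpleRoot b θ i).1 with hp
  have h : ∀ j, finiteCoeff b (reflectAffine P (simpleRoot b θ i) β).1 j =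
      finiteCoeff b β.1 j - p * finiteCoeff b (simpleRoot b θ i).1 j := by
    refine finiteCoeff_eq b ?_
    simp only [sub_smul, Finset.sum_sub_distrib, mul_smul, ← Finset.smul_sum,
      ← root_eq_sum_finiteCoeff]
    exact root_reflectAffine _ _
  have h1 : ∀ j, rootCoeff b θ (reflectAffine P (simpleRoot b θ i) β) j =
      rootCoeff b θ β j - p * rootCoeff b θ (simpleRoot b θ i) j := by
    rintro (_ | j)
    · rfl
    · simp only [rootCoeff, h]
      simp only [reflectAffine, ← hp]
      ring
  ext j
  rw [h1, rootCoeff_simpleRoot]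
  simp

/-- The pairing of a root with a simple root in terms of the affine Cartan matrix. -/
theorem pairingIn_eq_sum (β : AffineRealRoot ι) (i : Node b) :
    P.pairingIn ℤ β.1 (simpleRoot b θ i).1 =
      ∑ j, rootCoeff b θ β j * affineCartan b θ j i := by
  have h := congrArg (fun m ↦ P.toLinearMap m (P.coroot (simpleRoot b θ i).1))
    (root_eq_sum_rootCoeff (b := b) (θ := θ) β)
  simp only [map_sum, map_zsmul, LinearMap.sum_apply, LinearMap.smul_apply,
    RootPairing.root_coroot_eq_pairing, ← cast_pairingIn, zsmul_eq_mul] at h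
  exact_mod_cast h

theorem sum_deltaCoeff_mul_affineCartan (i : Node b) :
    ∑ j, deltaCoeff b θ j * affineCartan b θ j i = 0 := by
  have h := congrArg (fun m ↦ P.toLinearMap m (P.coroot (simpleRoot b θ i).1))
    (root_eq_sum_finiteCoeff b θ)
  simp only [map_sum, map_zsmul, LinearMap.sum_apply, LinearMap.smul_apply,
    RootPairing.root_coroot_eq_pairing, ← cast_pairingIn, zsmul_eq_mul] at h
  have h' : P.pairingIn ℤ θ (simpleRoot b θ i).1 =
    ∑ j, finiteCoeff b θ j * P.pairingIn ℤ j (simpleRoot b θ i).1 := by exact_mod_cast h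
  simp only [Fintype.sum_option, deltaCoeff, affineCartan, Matrix.of_apply]
  change 1 * P.pairingIn ℤ (P.reflectionPerm θ θ) (simpleRoot b θ i).1 +
    ∑ j : b.support, finiteCoeff b θ j * P.pairingIn ℤ j (simpleRoot b θ i).1 = 0
  rw [RootPairing.pairingIn_reflectionPerm_self_left, h']
  ring

/-- Expand `2 = ⟨β, β^∨⟩ = ∑ k_j ⟨α_j, β^∨⟩` with `k_j ≥ 0`: some `⟨α_j, β^∨⟩` is positive, and `⟨β,
α_j^∨⟩` has the same sign. -/
theorem exists_pos_pairingIn [Finite ι] (hθ : IsHighestRoot b θ) {β : AffineRealRoot ι}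
    (hβ : IsPositive b β) : ∃ i : Node b, 0 < P.pairingIn ℤ β.1 (simpleRoot b θ i).1 := by
  by_contra! hcon
  have h := congrArg (fun m ↦ P.toLinearMap m (P.coroot β.1))
    (root_eq_sum_rootCoeff (b := b) (θ := θ) β)
  simp only [map_sum, map_zsmul, LinearMap.sum_apply, LinearMap.smul_apply,
    RootPairing.root_coroot_eq_pairing, ← cast_pairingIn, zsmul_eq_mul] at h
  have h' : P.pairingIn ℤ β.1 β.1 =
    ∑ j, rootCoeff b θ β j * P.pairingIn ℤ (simpleRoot b θ j).1 β.1 := by exact_mod_cast h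
  rw [RootPairing.pairingIn_same] at h'
  have : ∑ j, rootCoeff b θ β j * P.pairingIn ℤ (simpleRoot b θ j).1 β.1 ≤ 0 := by
    refine Finset.sum_nonpos fun j _ ↦ mul_nonpos_of_nonneg_of_nonpos
      (rootCoeff_nonneg hθ hβ j) ?_
    have := hcon j
    rw [← not_lt, P.zero_lt_pairingIn_iff' ℤ, not_lt] at this
    exact this
  omega

variable [P.IsReduced]

/-- The reflection in `α_i` changes only the coefficient at `i`, and a positive root other than
`α_i` has another nonzero coefficient, which stays positive. -/
theorem isPositive_reflectAffine (hθ : IsHighestRoot b θ) {β : AffineRealRoot ι}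
    (hβ : IsPositive b β) {i : Node b} (h : β ≠ simpleRoot b θ i) :
    IsPositive b (reflectAffine P (simpleRoot b θ i) β) := by
  obtain ⟨j, hj, hj0⟩ : ∃ j ≠ i, rootCoeff b θ β j ≠ 0 := by
    by_contra! hcon
    exact h (eq_simpleRoot_of_rootCoeff hθ hβ hcon)
  refine isPositive_of_pos hθ (i := j) ?_
  rw [rootCoeff_reflectAffine]
  have := rootCoeff_nonneg hθ hβ j
  simp only [Pi.sub_apply, Pi.smul_apply, Pi.single_eq_of_ne hj, smul_zero, sub_zero]
  exact lt_of_le_of_ne this hj0.symm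

/-- Every affine reflection is a product of simple reflections. -/
theorem affineReflection_mem_closure [Finite ι] (hθ : IsHighestRoot b θ) (β : AffineRealRoot ι) :
    affineReflection P β ∈
      Subgroup.closure (Set.range fun i ↦ affineReflection P (simpleRoot b θ i)) := by
  have hs : ∀ i, affineReflection P (simpleRoot b θ i) ∈
      Subgroup.closure (Set.range fun i ↦ affineReflection P (simpleRoot b θ i)) :=
    fun i ↦ Subgroup.subset_closure ⟨i, rfl⟩
  -- Induction on the height of a positive root; `β` and `-β` define the same reflection.
  suffices H : ∀ n : ℕ, ∀ β : AffineRealRoot ι, IsPositive b β → ∑ j, rootCoeff b θ β j ≤ n →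
      affineReflection P β ∈
        Subgroup.closure (Set.range fun i ↦ affineReflection P (simpleRoot b θ i)) by
    by_cases hβ : IsPositive b β
    · exact H (∑ j, rootCoeff b θ β j).toNat β hβ (Int.self_le_toNat _)
    · rw [← affineReflection_negAffine]
      exact H (∑ j, rootCoeff b θ (negAffine P β) j).toNat _ ((isPositive_negAffine β).mpr hβ)
        (Int.self_le_toNat _)
  intro n
  induction n with
  | zero =>
    intro β hβ hle
    exfalso
    have h0 := rootCoeff_nonneg hθ hβ
    have := (Finset.sum_eq_zero_iff_of_nonneg (fun j _ ↦ h0 j)).mp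
      (le_antisymm hle (Finset.sum_nonneg fun j _ ↦ h0 j))
    exact rootCoeff_ne_zero β (funext fun j ↦ this j (Finset.mem_univ j))
  | succ n ih =>
    intro β hβ hle
    -- A positive pairing makes the height of the reflected root strictly smaller.
    obtain ⟨i, hi⟩ := exists_pos_pairingIn hθ hβ
    by_cases hβi : β = simpleRoot b θ i
    · rw [hβi]; exact hs i
    · have hsum : ∑ j, (Pi.single i 1 : Node b → ℤ) j = 1 := by simp
      have hmem := ih _ (isPositive_reflectAffine hθ hβ hβi) (by
        rw [rootCoeff_reflectAffine]
        simp only [Pi.sub_apply, Pi.smul_apply, Finset.sum_sub_distrib, smul_eq_mul,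
          ← Finset.mul_sum, hsum, mul_one]
        push_cast at hle
        omega)
      have := mul_mem (mul_mem (hs i) hmem) (hs i)
      rwa [← affineReflection_reflectAffine, reflectAffine_involutive] at this

end Coefficients

end AffineRootCombinatorics

/-! ### Coxeter relations of a simply laced diagram. -/

section GraphCoxeter

variable {I : Type*}

open Classical in
/-- The Coxeter matrix of a simply laced diagram. -/
def coxeterMatrix (G : SimpleGraph I) : CoxeterMatrix I where
  M := .of fun i j ↦ if i = j then 1 else if G.Adj i j then 3 else 2
  isSymm := by
    ext i j
    simp [eq_comm, G.adj_comm]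
  diagonal i := by simp
  off_diagonal i j h := by
    simp only [Matrix.of_apply, if_neg h]
    split_ifs <;> norm_num

/-- For involutions, `(f i * f j) ^ m = 1` with `m = 2, 3` is commutation or the braid relation. A
monoid is allowed because the Chinta-Gunnells operators are a priori only self-maps. -/
theorem isLiftable_coxeterMatrix (G : SimpleGraph I) {A : Type*} [Monoid A] {f : I → A}
    (hsq : ∀ i, f i * f i = 1)
    (hcomm : ∀ i j, i ≠ j → ¬ G.Adj i j → f i * f j = f j * f i)
    (hbraid : ∀ i j, G.Adj i j → f i * f j * f i = f j * f i * f j) :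
    (coxeterMatrix G).IsLiftable f := by
  intro i j
  by_cases hij : i = j
  · subst hij
    simp [coxeterMatrix, hsq]
  by_cases hG : G.Adj i j
  · have : coxeterMatrix G i j = 3 := by simp [coxeterMatrix, hij, hG]
    rw [this, pow_succ, pow_two]
    calc f i * f j * (f i * f j) * (f i * f j)
        = f i * f j * f i * f j * (f i * f j) := by simp only [mul_assoc]
      _ = f j * f i * (f j * f j) * (f i * f j) := by rw [hbraid i j hG]; simp only [mul_assoc]
      _ = f j * (f i * f i) * f j := by rw [hsq, mul_one]; simp only [mul_assoc]
      _ = 1 := by rw [hsq, mul_one, hsq]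
  · have : coxeterMatrix G i j = 2 := by simp [coxeterMatrix, hij, hG]
    rw [this, pow_two]
    calc f i * f j * (f i * f j) = f i * (f j * f i) * f j := by simp only [mul_assoc]
      _ = (f i * f i) * (f j * f j) := by rw [← hcomm i j hij hG]; simp only [mul_assoc]
      _ = 1 := by rw [hsq, hsq, mul_one]

end GraphCoxeter

/-! ### The affine Weyl group as the Coxeter group of its diagram. -/

section Presentation

variable {ι M N : Type*} [AddCommGroup M] [Module ℝ M] [AddCommGroup N] [Module ℝ N]
  {P : RootPairing ι ℝ M N} [P.IsCrystallographic] {b : P.Base} {θ : ι}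

theorem affineCartan_self (i : Node b) : affineCartan b θ i i = 2 :=
  P.pairingIn_same ℤ _

theorem affineCartan_eq_zero_of_not_adj {i j : Node b} (hij : i ≠ j)
    (h : ¬ (dynkin b θ).Adj i j) : affineCartan b θ i j = 0 := by
  by_contra hne
  exact h ((SimpleGraph.fromRel_adj _ _ _).mpr ⟨hij, Or.inl hne⟩)

theorem affineCartan_eq_neg_one_of_adj [Finite ι] (hsl : (affineCartan b θ).IsSimplyLaced)
    {i j : Node b} (h : (dynkin b θ).Adj i j) : affineCartan b θ i j = -1 := by
  obtain ⟨hij, h⟩ := (SimpleGraph.fromRel_adj _ _ _).mp h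
  refine (hsl hij).resolve_left fun h0 ↦ ?_
  have h0' : affineCartan b θ j i = 0 := P.pairingIn_eq_zero_iff.mp h0
  exact h.elim (fun h ↦ h h0) fun h ↦ h h0'

theorem affineReflection_simple_apply (i j : Node b) (x : N) :
    affineFunction P (simpleRoot b θ i) (affineReflection P (simpleRoot b θ j) x) =
      affineFunction P (simpleRoot b θ i) x -
        affineCartan b θ i j * affineFunction P (simpleRoot b θ j) x := by
  rw [affineReflection_apply]
  simp only [affineFunction, map_sub, map_smul, RootPairing.root_coroot_eq_pairing, smul_eq_mul,
    affineCartan, Matrix.of_apply, cast_pairingIn]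
  ring

theorem affineReflection_comm {i j : Node b} (hij : i ≠ j) (h : ¬ (dynkin b θ).Adj i j) (x : N) :
    affineReflection P (simpleRoot b θ i) (affineReflection P (simpleRoot b θ j) x) =
      affineReflection P (simpleRoot b θ j) (affineReflection P (simpleRoot b θ i) x) := by
  have h' : ¬ (dynkin b θ).Adj j i := fun h' ↦ h h'.symm
  rw [affineReflection_apply (simpleRoot b θ i) (affineReflection P (simpleRoot b θ j) x),
    affineReflection_apply (simpleRoot b θ j) (affineReflection P (simpleRoot b θ i) x),
    affineReflection_simple_apply, affineReflection_simple_apply,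
    affineCartan_eq_zero_of_not_adj hij h, affineCartan_eq_zero_of_not_adj hij.symm h',
    affineReflection_apply _ x, affineReflection_apply _ x]
  simp only [Int.cast_zero, zero_mul, sub_zero]
  abel

theorem affineReflection_braid [Finite ι] (hsl : (affineCartan b θ).IsSimplyLaced)
    {i j : Node b} (h : (dynkin b θ).Adj i j) (x : N) :
    affineReflection P (simpleRoot b θ i) (affineReflection P (simpleRoot b θ j)
        (affineReflection P (simpleRoot b θ i) x)) =
      affineReflection P (simpleRoot b θ j) (affineReflection P (simpleRoot b θ i)
        (affineReflection P (simpleRoot b θ j) x)) := by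
  -- Each side is the reflection in `α_i + α_j`, in a form symmetric in `i` and `j`.
  have key : ∀ {i j : Node b}, (dynkin b θ).Adj i j →
      affineReflection P (simpleRoot b θ i) (affineReflection P (simpleRoot b θ j)
        (affineReflection P (simpleRoot b θ i) x)) =
      x - (affineFunction P (simpleRoot b θ i) x + affineFunction P (simpleRoot b θ j) x) •
        (P.coroot (simpleRoot b θ i).1 + P.coroot (simpleRoot b θ j).1) := by
    intro i j h
    rw [affineReflection_apply (simpleRoot b θ i), affineReflection_apply (simpleRoot b θ j),
      ← affineReflection_apply (simpleRoot b θ j),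
      affineReflection_simple_apply i j, affineReflection_simple_apply i i,
      affineReflection_simple_apply j i, affineReflection_apply (simpleRoot b θ j),
      affineReflection_simple_apply j i, affineReflection_apply (simpleRoot b θ i),
      affineCartan_eq_neg_one_of_adj hsl h,
      affineCartan_eq_neg_one_of_adj hsl h.symm, affineCartan_self]
    push_cast
    module
  rw [key h, key h.symm]
  module

/-- The group presented by the Coxeter relations of the affine diagram. -/
abbrev DiagramGroup (b : P.Base) (θ : ι) : Type _ := (coxeterMatrix (dynkin b θ)).Group

/-- The Coxeter system of the group presented by the affine diagram. -/
def diagramSystem (b : P.Base) (θ : ι) :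
    CoxeterSystem (coxeterMatrix (dynkin b θ)) (DiagramGroup b θ) :=
  (coxeterMatrix (dynkin b θ)).toCoxeterSystem

/-- A simple reflection as a permutation of the affine real roots. -/
def reflectPerm (b : P.Base) (θ : ι) (i : Node b) : Equiv.Perm (AffineRealRoot ι) :=
  Function.Involutive.toPerm _ (reflectAffine_involutive (P := P) (simpleRoot b θ i))

theorem reflectPerm_apply (i : Node b) (β : AffineRealRoot ι) :
    reflectPerm b θ i β = reflectAffine P (simpleRoot b θ i) β := rfl

theorem reflectAffine_simpleRoot_of_not_adj {i j : Node b} (hij : i ≠ j)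
    (h : ¬ (dynkin b θ).Adj i j) :
    reflectAffine P (simpleRoot b θ j) (simpleRoot b θ i) = simpleRoot b θ i := by
  apply rootCoeff_injective (b := b) (θ := θ)
  have : P.pairingIn ℤ (simpleRoot b θ i).1 (simpleRoot b θ j).1 = 0 :=
    affineCartan_eq_zero_of_not_adj hij h
  rw [rootCoeff_reflectAffine, this]
  simp

variable [Finite ι] (hsl : (affineCartan b θ).IsSimplyLaced)

/-- A root is determined by its affine function, and reflecting the root is precomposition with the
reflection of `N`; the relations are thus inherited from the points of `N`. -/
theorem isLiftable_reflectPerm (hsl : (affineCartan b θ).IsSimplyLaced) :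
    (coxeterMatrix (dynkin b θ)).IsLiftable (reflectPerm b θ) := by
  refine isLiftable_coxeterMatrix _ (fun i ↦ ?_) (fun i j hij h ↦ ?_) (fun i j h ↦ ?_) <;>
    refine Equiv.ext fun β ↦ affineFunction_injective (P := P) (funext fun x ↦ ?_) <;>
    simp only [Equiv.Perm.coe_mul, Function.comp_apply, reflectPerm_apply,
      affineFunction_reflectAffine, Equiv.Perm.coe_one, id_eq]
  · rw [affineReflection_involutive]
  · rw [affineReflection_comm hij h]
  · rw [affineReflection_braid hsl h]

theorem isLiftable_simpleReflection (hsl : (affineCartan b θ).IsSimplyLaced) :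
    (coxeterMatrix (dynkin b θ)).IsLiftable (simpleReflection b θ) := by
  refine isLiftable_coxeterMatrix _ (fun i ↦ ?_) (fun i j hij h ↦ ?_) (fun i j h ↦ ?_) <;>
    refine Subtype.ext (AffineEquiv.ext fun x ↦ ?_)
  · exact affineReflection_involutive _ x
  · exact affineReflection_comm hij h x
  · exact affineReflection_braid hsl h x

/-- The action of the group presented by the diagram on the affine real roots. -/
def rootAction : DiagramGroup b θ →* Equiv.Perm (AffineRealRoot ι) :=
  (diagramSystem b θ).lift ⟨_, isLiftable_reflectPerm hsl⟩

/-- The map from the group presented by the diagram to the affine Weyl group. -/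
def toAffineWeylGroup : DiagramGroup b θ →* affineWeylGroup P :=
  (diagramSystem b θ).lift ⟨_, isLiftable_simpleReflection hsl⟩

@[simp]
theorem rootAction_simple (i : Node b) :
    rootAction hsl ((diagramSystem b θ).simple i) = reflectPerm b θ i :=
  (diagramSystem b θ).lift_apply_simple _ i

@[simp]
theorem toAffineWeylGroup_simple (i : Node b) :
    toAffineWeylGroup hsl ((diagramSystem b θ).simple i) = simpleReflection b θ i :=
  (diagramSystem b θ).lift_apply_simple _ i

theorem toAffineWeylGroup_wordProd (l : List (Node b)) :
    toAffineWeylGroup hsl ((diagramSystem b θ).wordProd l) = wordProd b θ l := by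
  simp [CoxeterSystem.wordProd, wordProd, map_list_prod, Function.comp_def]

/-- Links the two actions: an element acting trivially on `N` fixes every real root. -/
theorem affineFunction_rootAction (w : DiagramGroup b θ) (β : AffineRealRoot ι) (x : N) :
    affineFunction P (rootAction hsl w β) ((toAffineWeylGroup hsl w : N ≃ᵃ[ℝ] N) x) =
      affineFunction P β x := by
  induction w using (diagramSystem b θ).simple_induction_left with
  | one => simp
  | mul_simple_left w i ih =>
    rw [map_mul, map_mul, rootAction_simple, toAffineWeylGroup_simple, Equiv.Perm.mul_apply,
      reflectPerm_apply, affineFunction_reflectAffine, ← ih]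
    congr 1
    exact affineReflection_involutive _ _

/-- Roots cannot be added freely, so linearity of the action is expressed through coefficients. It
is needed for `w (α_i + α_j)` and `w (-β)`. -/
theorem exists_linear_rootAction (w : DiagramGroup b θ) :
    ∃ T : (Node b → ℤ) →+ (Node b → ℤ), ∀ β,
      rootCoeff b θ (rootAction hsl w β) = T (rootCoeff b θ β) := by
  classical
  induction w using (diagramSystem b θ).simple_induction_left with
  | one => exact ⟨AddMonoidHom.id _, fun β ↦ by simp⟩
  | mul_simple_left w i ih =>
    obtain ⟨T, hT⟩ := ih
    let R : (Node b → ℤ) →+ (Node b → ℤ) :=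
      AddMonoidHom.mk' (fun c ↦ c - (∑ j, c j * affineCartan b θ j i) • Pi.single i 1) (by
        intro c d
        simp only [Pi.add_apply, add_mul, Finset.sum_add_distrib, add_smul]
        abel)
    refine ⟨R.comp T, fun β ↦ ?_⟩
    rw [map_mul, rootAction_simple, Equiv.Perm.mul_apply, reflectPerm_apply,
      rootCoeff_reflectAffine, pairingIn_eq_sum (b := b) (θ := θ), AddMonoidHom.comp_apply, ← hT]
    ext j
    simp [R, Pi.single_apply]

theorem rootCoeff_reflectAffine_of_adj (hsl : (affineCartan b θ).IsSimplyLaced)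
    {i j : Node b} (h : (dynkin b θ).Adj i j) :
    rootCoeff b θ (reflectAffine P (simpleRoot b θ j) (simpleRoot b θ i)) =
      rootCoeff b θ (simpleRoot b θ i) + rootCoeff b θ (simpleRoot b θ j) := by
  have : P.pairingIn ℤ (simpleRoot b θ i).1 (simpleRoot b θ j).1 = -1 :=
    affineCartan_eq_neg_one_of_adj hsl h
  rw [rootCoeff_reflectAffine, this, rootCoeff_simpleRoot, rootCoeff_simpleRoot]
  simp

theorem rootAction_mul_simple_apply (w : DiagramGroup b θ) (i : Node b) (β : AffineRealRoot ι) :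
    rootAction hsl (w * (diagramSystem b θ).simple i) β =
      rootAction hsl w (reflectAffine P (simpleRoot b θ i) β) := by
  rw [map_mul, rootAction_simple, Equiv.Perm.mul_apply, reflectPerm_apply]

/-- If multiplying `w` by a simple reflection on the right increases its length, then `w` maps the
simple root to a positive root. -/
theorem isPositive_rootAction_of_length_lt (hθ : IsHighestRoot b θ) (n : ℕ) :
    ∀ w : DiagramGroup b θ, (diagramSystem b θ).length w ≤ n → ∀ i : Node b,
      ¬ (diagramSystem b θ).IsRightDescent w i →
      IsPositive b (rootAction hsl w (simpleRoot b θ i)) := by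
  set cs := diagramSystem b θ with hcs
  induction n using Nat.strong_induction_on with
  | _ n ih =>
  intro w hw i hi
  by_cases hw1 : w = 1
  · subst hw1
    simpa using isPositive_simpleRoot hθ i
  obtain ⟨j, hj⟩ := cs.exists_rightDescent_of_ne_one hw1
  have hij : i ≠ j := fun h ↦ hi (h ▸ hj)
  have hlen := cs.isRightDescent_iff.mp hj
  have hleni := cs.not_isRightDescent_iff.mp hi
  set w' := w * cs.simple j with hw'
  have hww' : w = w' * cs.simple j := by rw [hw', cs.simple_mul_simple_cancel_right]
  clear_value w'
  have hj' : ¬ cs.IsRightDescent w' j := by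
    rw [cs.not_isRightDescent_iff, ← hww', hlen]
  rw [hww', rootAction_mul_simple_apply]
  by_cases hadj : (dynkin b θ).Adj i j
  -- From here `w = w' σ_j` with `w'` shorter. In the adjacent case `σ_j α_i = α_i + α_j`, and the
  -- argument splits on whether `w'` can be shortened by `σ_i`.
  · have hm : cs.simple i * cs.simple j * cs.simple i =
        cs.simple j * cs.simple i * cs.simple j := by
      have h3 := cs.simple_mul_simple_pow i j
      have : coxeterMatrix (dynkin b θ) i j = 3 := by simp [coxeterMatrix, hij, hadj]
      rw [this, pow_succ, pow_two] at h3
      have : cs.simple i * cs.simple j * cs.simple i *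
          (cs.simple j * cs.simple i * cs.simple j) = 1 := by
        simpa only [mul_assoc] using h3
      have hinv := eq_inv_of_mul_eq_one_left this
      rw [hinv, mul_inv_rev, mul_inv_rev, cs.inv_simple, cs.inv_simple]
      simp only [mul_assoc]
    by_cases hi' : cs.IsRightDescent w' i
    -- Now `w = w'' σ_i σ_j` and `σ_i σ_j α_i = α_j`, so `w α_i = w'' α_j`. If `σ_j` shortened
    -- `w''`, the braid relation `w σ_i = w'' σ_j σ_i σ_j` would make `w σ_i` too short.
    · have hlen' := cs.isRightDescent_iff.mp hi'
      set w'' := w' * cs.simple i with hw''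
      have hww'' : w' = w'' * cs.simple i := by rw [hw'', cs.simple_mul_simple_cancel_right]
      have hj'' : ¬ cs.IsRightDescent w'' j := by
        intro hd
        have h1 := cs.isRightDescent_iff.mp hd
        have h2 : w * cs.simple i = w'' * cs.simple j * cs.simple i * cs.simple j := by
          rw [hww', hww'']
          calc w'' * cs.simple i * cs.simple j * cs.simple i
              = w'' * (cs.simple i * cs.simple j * cs.simple i) := by simp only [mul_assoc]
            _ = _ := by rw [hm]; simp only [mul_assoc]
        have h3 := cs.length_mul_le (w'' * cs.simple j * cs.simple i) (cs.simple j)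
        have h4 := cs.length_mul_le (w'' * cs.simple j) (cs.simple i)
        rw [← h2] at h3
        rw [cs.length_simple] at h3 h4
        omega
      have hroot : reflectAffine P (simpleRoot b θ i)
          (reflectAffine P (simpleRoot b θ j) (simpleRoot b θ i)) = simpleRoot b θ j := by
        apply rootCoeff_injective (b := b) (θ := θ)
        have h1 := rootCoeff_reflectAffine_of_adj hsl hadj
        have h2 := rootCoeff_reflectAffine_of_adj hsl hadj.symm
        have h3 : reflectAffine P (simpleRoot b θ j) (simpleRoot b θ i) =
            reflectAffine P (simpleRoot b θ i) (simpleRoot b θ j) := by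
          apply rootCoeff_injective (b := b) (θ := θ)
          rw [h1, h2, add_comm]
        rw [h3, reflectAffine_involutive]
      rw [hww'', rootAction_mul_simple_apply, hroot]
      exact ih _ (by omega) w'' le_rfl j hj''
    -- Here `w α_i = w' α_i + w' α_j`, a sum of two positive roots by induction.
    · have hp1 := rootCoeff_nonneg hθ (ih _ (by omega) w' le_rfl i hi')
      have hp2 := rootCoeff_nonneg hθ (ih _ (by omega) w' le_rfl j hj')
      obtain ⟨T, hT⟩ := exists_linear_rootAction hsl w'
      rw [isPositive_iff hθ, hT, rootCoeff_reflectAffine_of_adj hsl hadj, map_add, ← hT, ← hT]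
      exact add_nonneg hp1 hp2
  -- Here `w α_i = w' α_i`; a descent of `w'` at `i` would, by commutation, make `w σ_i` too short.
  · rw [reflectAffine_simpleRoot_of_not_adj hij hadj]
    refine ih _ (by omega) w' le_rfl i fun hd ↦ ?_
    have h1 := cs.isRightDescent_iff.mp hd
    have hadj' : ¬ (dynkin b θ).Adj j i := fun h ↦ hadj h.symm
    have hc : cs.simple j * cs.simple i = cs.simple i * cs.simple j := by
      have h3 := cs.simple_mul_simple_pow j i
      have : coxeterMatrix (dynkin b θ) j i = 2 := by
        simp [coxeterMatrix, hij.symm, hadj']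
      rw [this, pow_two] at h3
      have hinv := eq_inv_of_mul_eq_one_left h3
      rw [hinv, mul_inv_rev, cs.inv_simple, cs.inv_simple]
    have h2 : w * cs.simple i = w' * cs.simple i * cs.simple j := by
      calc w * cs.simple i = w' * (cs.simple j * cs.simple i) := by rw [hww', mul_assoc]
        _ = _ := by rw [hc, ← mul_assoc]
    have h4 := cs.length_mul_le (w' * cs.simple i) (cs.simple j)
    rw [← h2, cs.length_simple] at h4
    omega

/-- For the converse, a descent `i` of `w` is not one of `w σ_i`, so `w σ_i α_i = -w α_i` is
positive, and `w α_i` cannot be positive too. -/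
theorem isPositive_rootAction_iff (hθ : IsHighestRoot b θ) (w : DiagramGroup b θ) (i : Node b) :
    IsPositive b (rootAction hsl w (simpleRoot b θ i)) ↔
      ¬ (diagramSystem b θ).IsRightDescent w i := by
  refine ⟨fun h hd ↦ ?_, fun h ↦ isPositive_rootAction_of_length_lt hsl hθ _ w le_rfl i h⟩
  rw [CoxeterSystem.isRightDescent_iff_not_isRightDescent_mul] at hd
  have h1 := isPositive_rootAction_of_length_lt hsl hθ _ _ le_rfl i hd
  rw [rootAction_mul_simple_apply, reflectAffine_self] at h1
  obtain ⟨T, hT⟩ := exists_linear_rootAction hsl w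
  have h2 := rootCoeff_nonneg hθ h
  have h3 := rootCoeff_nonneg hθ h1
  rw [hT, rootCoeff_negAffine, map_neg, ← hT] at h3
  exact rootCoeff_ne_zero _ (le_antisymm (neg_nonneg.mp h3) h2)

theorem eq_one_of_forall_isPositive (hθ : IsHighestRoot b θ) {w : DiagramGroup b θ}
    (h : ∀ i, IsPositive b (rootAction hsl w (simpleRoot b θ i))) : w = 1 := by
  by_contra hw
  obtain ⟨i, hi⟩ := (diagramSystem b θ).exists_rightDescent_of_ne_one hw
  exact (isPositive_rootAction_iff hsl hθ w i).mp (h i) hi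

theorem toAffineWeylGroup_injective (hθ : IsHighestRoot b θ) :
    Function.Injective (toAffineWeylGroup hsl) := by
  rw [injective_iff_map_eq_one]
  intro w hw
  refine eq_one_of_forall_isPositive hsl hθ fun i ↦ ?_
  have : rootAction hsl w (simpleRoot b θ i) = simpleRoot b θ i := by
    apply affineFunction_injective (P := P)
    ext x
    simpa [hw] using affineFunction_rootAction hsl w (simpleRoot b θ i) x
  rw [this]
  exact isPositive_simpleRoot hθ i

theorem toAffineWeylGroup_surjective [P.IsReduced] (hθ : IsHighestRoot b θ) :
    Function.Surjective (toAffineWeylGroup hsl) := by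
  have hle : affineWeylGroup P ≤
      (toAffineWeylGroup hsl).range.map (affineWeylGroup P).subtype := by
    refine (Subgroup.closure_le _).mpr ?_
    rintro _ ⟨β, rfl⟩
    have h := affineReflection_mem_closure hθ β
    refine (Subgroup.closure_le _).mpr ?_ h
    rintro _ ⟨i, rfl⟩
    exact ⟨simpleReflection b θ i, ⟨_, toAffineWeylGroup_simple hsl i⟩, rfl⟩
  rintro ⟨g, hg⟩
  obtain ⟨g', ⟨w, rfl⟩, h⟩ := hle hg
  exact ⟨w, Subtype.ext h⟩

/-- The affine Weyl group is presented by the Coxeter relations of its diagram. -/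
def affineWeylGroupEquiv [P.IsReduced] (hθ : IsHighestRoot b θ) :
    DiagramGroup b θ ≃* affineWeylGroup P :=
  MulEquiv.ofBijective (toAffineWeylGroup hsl)
    ⟨toAffineWeylGroup_injective hsl hθ, toAffineWeylGroup_surjective hsl hθ⟩

end Presentation

/-! ### The Chinta-Gunnells operators satisfy the Coxeter relations. -/

section RationalAction

variable {I : Type*}

theorem ratFun_ringHom_ext {F : Type*} [Field F] {φ ψ : RatFun I →+* F}
    (hC : ∀ c, φ (algebraMap ℂ (RatFun I) c) = ψ (algebraMap ℂ (RatFun I) c))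
    (hX : ∀ i, φ (varX i) = ψ (varX i)) (hU : φ varU = ψ varU) : φ = ψ := by
  refine IsLocalization.ringHom_ext (nonZeroDivisors (Poly I)) (MvPolynomial.ringHom_ext ?_ ?_)
  · exact hC
  rintro (i | ⟨⟩)
  · exact hX i
  · exact hU

theorem varX_ne_zero (i : I) : (varX i : RatFun I) ≠ 0 := by
  rw [varX, Ne, IsFractionRing.to_map_eq_zero_iff]
  exact MvPolynomial.X_ne_zero _

variable (G : SimpleGraph I) (i j : I)

@[simp]
theorem substReflect_algebraMap (p : Poly I) :
    substReflect G i (algebraMap (Poly I) (RatFun I) p) = substPoly (reflectVars G i varX) p :=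
  IsFractionRing.lift_algebraMap _ _

@[simp]
theorem substSignReflect_algebraMap (p : Poly I) :
    substSignReflect G i (algebraMap (Poly I) (RatFun I) p) =
      substPoly (signVars G i (reflectVars G i varX)) p :=
  IsFractionRing.lift_algebraMap _ _

@[simp]
theorem substReflect_C (c : ℂ) :
    substReflect G i (algebraMap ℂ (RatFun I) c) = algebraMap ℂ (RatFun I) c := by
  rw [IsScalarTower.algebraMap_apply ℂ (Poly I) (RatFun I), substReflect_algebraMap,
    AlgHom.commutes, ← IsScalarTower.algebraMap_apply]

@[simp]
theorem substSignReflect_C (c : ℂ) :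
    substSignReflect G i (algebraMap ℂ (RatFun I) c) = algebraMap ℂ (RatFun I) c := by
  rw [IsScalarTower.algebraMap_apply ℂ (Poly I) (RatFun I), substSignReflect_algebraMap,
    AlgHom.commutes, ← IsScalarTower.algebraMap_apply]

@[simp]
theorem substReflect_varU : substReflect G i varU = varU := by
  rw [varU, substReflect_algebraMap]
  simp [substPoly, varU]

@[simp]
theorem substSignReflect_varU : substSignReflect G i varU = varU := by
  rw [varU, substSignReflect_algebraMap]
  simp [substPoly, varU]

theorem substReflect_varX : substReflect G i (varX j) = reflectVars G i varX j := by
  rw [varX, substReflect_algebraMap]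
  simp [substPoly]

theorem substSignReflect_varX :
    substSignReflect G i (varX j) = signVars G i (reflectVars G i varX) j := by
  rw [varX, substSignReflect_algebraMap]
  simp [substPoly]

/-- The substitution `f ↦ f(εᵢ x; u)` on rational functions. -/
def substSign (G : SimpleGraph I) (i : I) : RatFun I →+* RatFun I :=
  (substSignReflect G i).comp (substReflect G i)

@[simp]
theorem substSign_varU : substSign G i varU = varU := by simp [substSign]

@[simp]
theorem substSign_C (c : ℂ) :
    substSign G i (algebraMap ℂ (RatFun I) c) = algebraMap ℂ (RatFun I) c := by
  simp [substSign]

open Classical in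
theorem substReflect_varX' : substReflect G i (varX j) =
    if j = i then (varX i)⁻¹ else if G.Adj j i then varX i * varX j else varX j := by
  rw [substReflect_varX, reflectVars]
  split_ifs with h
  · rw [h]
  · rfl
  · rfl

open Classical in
theorem substSign_varX :
    substSign G i (varX j) = if G.Adj j i then -varX j else varX j := by
  have hi := varX_ne_zero i
  rw [substSign, RingHom.comp_apply, substReflect_varX', apply_ite (substSignReflect G i),
    apply_ite (substSignReflect G i)]
  simp only [map_inv₀, map_mul, substSignReflect_varX, signVars, reflectVars]
  by_cases h : j = i
  · subst h; simp
  · by_cases hG : G.Adj j i <;> simp [h, hG, hi]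

theorem substReflect_substReflect (f : RatFun I) : substReflect G i (substReflect G i f) = f := by
  have : (substReflect G i).comp (substReflect G i) = RingHom.id _ := by
    refine ratFun_ringHom_ext (fun c ↦ by simp) (fun k ↦ ?_) (by simp)
    have hi := varX_ne_zero i
    by_cases hk : k = i
    · subst hk; simp [substReflect_varX']
    · by_cases hG : G.Adj k i <;> simp [substReflect_varX', hk, hG, hi]
  exact RingHom.congr_fun this f

theorem substSign_substSign (f : RatFun I) : substSign G i (substSign G i f) = f := by
  have : (substSign G i).comp (substSign G i) = RingHom.id _ := by
    refine ratFun_ringHom_ext (fun c ↦ by simp) (fun k ↦ ?_) (by simp)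
    by_cases hG : G.Adj k i <;> simp [substSign_varX, hG]
  exact RingHom.congr_fun this f

theorem substSign_comm (f : RatFun I) :
    substSign G i (substSign G j f) = substSign G j (substSign G i f) := by
  have : (substSign G i).comp (substSign G j) = (substSign G j).comp (substSign G i) := by
    refine ratFun_ringHom_ext (fun c ↦ by simp) (fun k ↦ ?_) (by simp)
    by_cases hG : G.Adj k i <;> by_cases hG' : G.Adj k j <;> simp [substSign_varX, hG, hG']
  exact RingHom.congr_fun this f

theorem substSign_substReflect_of_not_adj {i j : I} (h : ¬ G.Adj i j) (f : RatFun I) :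
    substSign G i (substReflect G j f) = substReflect G j (substSign G i f) := by
  have hadj : ¬ G.Adj j i := fun h' ↦ h h'.symm
  have : (substSign G i).comp (substReflect G j) = (substReflect G j).comp (substSign G i) := by
    refine ratFun_ringHom_ext (fun c ↦ by simp) (fun k ↦ ?_) (by simp)
    by_cases hk : k = j
    · subst hk; simp [substReflect_varX', substSign_varX, hadj]
    · by_cases hG : G.Adj k i <;> by_cases hG' : G.Adj k j <;>
        simp [substReflect_varX', substSign_varX, hk, hG, hG', hadj]
  exact RingHom.congr_fun this f

/-- Splits `ε_i σ_i` into `ε_i` and `σ_i`, so that the relations can be computed with commuting sign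
changes. -/
theorem substSignReflect_eq (f : RatFun I) :
    substSignReflect G i f = substSign G i (substReflect G i f) := by
  rw [substSign, RingHom.comp_apply, substReflect_substReflect]

theorem substReflect_comm {i j : I} (hij : i ≠ j) (h : ¬ G.Adj i j) (f : RatFun I) :
    substReflect G i (substReflect G j f) = substReflect G j (substReflect G i f) := by
  have hadj : ¬ G.Adj j i := fun h' ↦ h h'.symm
  have : (substReflect G i).comp (substReflect G j) =
      (substReflect G j).comp (substReflect G i) := by
    refine ratFun_ringHom_ext (fun c ↦ by simp) (fun k ↦ ?_) (by simp)
    by_cases hki : k = i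
    · subst hki
      simp [substReflect_varX', hij, h]
    by_cases hkj : k = j
    · subst hkj
      simp [substReflect_varX', hij.symm, hadj]
    by_cases hG : G.Adj k i <;> by_cases hG' : G.Adj k j <;>
      simp [substReflect_varX', hki, hkj, hG, hG', hadj, h, hij, hij.symm, mul_left_comm]
  exact RingHom.congr_fun this f

/-- For adjacent nodes `ε_j` negates `x_i`, and this sign enters every product `x_i x_k` with `k ∼
i`; hence the additional `ε_i` when `σ_i` is moved past `ε_j`. -/
theorem substReflect_substSign_of_adj {i j : I} (h : G.Adj i j) (f : RatFun I) :
    substReflect G i (substSign G j f) = substSign G i (substSign G j (substReflect G i f)) := by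
  have hij := h.ne
  have : (substReflect G i).comp (substSign G j) =
      (substSign G i).comp ((substSign G j).comp (substReflect G i)) := by
    refine ratFun_ringHom_ext (fun c ↦ by simp) (fun k ↦ ?_) (by simp)
    by_cases hki : k = i
    · subst hki
      simp [substReflect_varX', substSign_varX, h]
      exact neg_inv
    by_cases hkj : k = j
    · subst hkj
      simp [substReflect_varX', substSign_varX, hij.symm, h.symm, h]
    by_cases hG : G.Adj k i <;> by_cases hG' : G.Adj k j <;>
      simp [substReflect_varX', substSign_varX, hki, hG, hG', h]
  exact RingHom.congr_fun this f

theorem substReflect_braid {i j : I} (h : G.Adj i j) (f : RatFun I) :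
    substReflect G i (substReflect G j (substReflect G i f)) =
      substReflect G j (substReflect G i (substReflect G j f)) := by
  have hij := h.ne
  have hi := varX_ne_zero i
  have hj := varX_ne_zero j
  have : (substReflect G i).comp ((substReflect G j).comp (substReflect G i)) =
      (substReflect G j).comp ((substReflect G i).comp (substReflect G j)) := by
    refine ratFun_ringHom_ext (fun c ↦ by simp) (fun k ↦ ?_) (by simp)
    by_cases hki : k = i
    · subst hki
      simp [substReflect_varX', h, h.symm, hij, hij.symm]
      try field_simp
    by_cases hkj : k = j
    · subst hkj
      simp [substReflect_varX', h, h.symm, hij, hij.symm]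
      try field_simp
    by_cases hG : G.Adj k i <;> by_cases hG' : G.Adj k j <;>
      simp [substReflect_varX', h, h.symm, hij, hij.symm, hki, hkj, hG, hG']
    all_goals field_simp
  exact RingHom.congr_fun this f

theorem map_J {F F' : Type*} [Field F] [Field F'] (φ : F →+* F') (x u : F) (e : ℕ) :
    φ (J x u e) = J (φ x) (φ u) e := by
  simp only [J, map_mul, map_div₀, map_sub, map_one, map_pow, map_neg, map_ofNat]

theorem J_zero_eq {F : Type*} [Field F] {x u : F} (h : 1 - u * x ≠ 0) :
    J x u 0 = -(x * (1 - u) * (1 + x)) / (2 * (1 - u * x)) := by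
  rw [J, div_sub' h, pow_zero, div_mul_div_comm]
  congr 1
  ring

theorem J_one_eq {F : Type*} [Field F] {x u : F} (h : 1 - u * x ≠ 0) :
    J x u 1 = x * (1 + u) * (1 - x) / (2 * (1 - u * x)) := by
  rw [J, div_sub' h, pow_one, div_mul_div_comm]
  congr 1
  ring

/-- Equality of the coefficients of `ε_i g` on the two sides of the braid relation, with `a = x_i`
and `b = x_j`. -/
theorem J_braid_sign {F : Type*} [Field F] [CharZero F] {a b u : F} (ha : 1 - u * a ≠ 0)
    (hb : 1 - u * b ≠ 0) (hb' : 1 + u * b ≠ 0) (hab : 1 - u * (a * b) ≠ 0)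
    (hab' : 1 + u * (a * b) ≠ 0) :
    J (-b) u 1 * J (a * b) u 1 * J a u 0 + J (-b) u 0 * J (-(a * b)) u 0 * J a u 1 =
      J a u 1 * J (b * a) u 0 * J b u 0 + J a u 0 * J (-(b * a)) u 1 * J b u 1 := by
  have h1 : ∀ c : F, 1 - u * -c = 1 + u * c := fun c ↦ by ring
  rw [mul_comm b a, J_one_eq ha, J_zero_eq ha, J_one_eq hb, J_zero_eq hb, J_one_eq hab,
    J_zero_eq hab, J_one_eq (x := -b) (by rwa [h1]), J_zero_eq (x := -b) (by rwa [h1]),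
    J_one_eq (x := -(a * b)) (by rwa [h1]), J_zero_eq (x := -(a * b)) (by rwa [h1]), h1, h1]
  -- The denominators become atoms while fractions are cleared; those still needed are expanded
  -- again for the final polynomial identity.
  generalize hp : 1 - u * a = p at ha
  generalize hq : 1 - u * b = q at hb
  generalize hq' : 1 + u * b = q' at hb'
  generalize hr : 1 - u * (a * b) = r at hab
  generalize hr' : 1 + u * (a * b) = r' at hab'
  field_simp
  simp only [← hq, ← hq', ← hr, ← hr']
  ring

/-- The corresponding equality for the coefficients of `ε_i ε_j g`. -/
theorem J_braid_sign_sign {F : Type*} [Field F] [CharZero F] {a b u : F} (ha : 1 - u * a ≠ 0)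
    (ha' : 1 + u * a ≠ 0) (hb : 1 - u * b ≠ 0) (hb' : 1 + u * b ≠ 0) (hab : 1 - u * (a * b) ≠ 0)
    (hab' : 1 + u * (a * b) ≠ 0) :
    J (-b) u 0 * J (a * b) u 1 * J a u 0 + J (-b) u 1 * J (-(a * b)) u 0 * J a u 1 =
      J (-a) u 0 * J (b * a) u 1 * J b u 0 + J (-a) u 1 * J (-(b * a)) u 0 * J b u 1 := by
  have h1 : ∀ c : F, 1 - u * -c = 1 + u * c := fun c ↦ by ring
  rw [mul_comm b a, J_one_eq ha, J_zero_eq ha, J_one_eq hb, J_zero_eq hb, J_one_eq hab,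
    J_one_eq (x := -a) (by rwa [h1]), J_zero_eq (x := -a) (by rwa [h1]),
    J_one_eq (x := -b) (by rwa [h1]), J_zero_eq (x := -b) (by rwa [h1]),
    J_zero_eq (x := -(a * b)) (by rwa [h1]), h1, h1, h1]
  generalize hp : 1 - u * a = p at ha
  generalize hp' : 1 + u * a = p' at ha'
  generalize hq : 1 - u * b = q at hb
  generalize hq' : 1 + u * b = q' at hb'
  generalize hr : 1 - u * (a * b) = r at hab
  generalize hr' : 1 + u * (a * b) = r' at hab'
  field_simp
  simp only [← hp, ← hp', ← hq, ← hq', ← hr, ← hr']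
  ring
theorem one_sub_varU_mul_ne_zero {x : RatFun I}
    (hx : ∃ p : Poly I, x = algebraMap (Poly I) (RatFun I) p) : 1 - varU * x ≠ 0 := by
  obtain ⟨p, rfl⟩ := hx
  intro h
  rw [varU, ← map_mul, ← map_one (algebraMap (Poly I) (RatFun I)), ← map_sub,
    IsFractionRing.to_map_eq_zero_iff] at h
  have := congrArg (MvPolynomial.eval (0 : I ⊕ Unit → ℂ)) h
  simp at this

theorem varU_sub_varX_ne_zero : (varU : RatFun I) - varX i ≠ 0 := by
  intro h
  rw [varU, varX, ← map_sub, IsFractionRing.to_map_eq_zero_iff] at h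
  have := congrArg (MvPolynomial.eval (Sum.elim (fun _ ↦ 0) fun _ ↦ 1 : I ⊕ Unit → ℂ)) h
  simp at this

theorem slashSimple_eq (f : RatFun I) :
    slashSimple G i f = substReflect G i f * J (varX i) varU 0 +
      substSign G i (substReflect G i f) * J (varX i) varU 1 := by
  rw [slashSimple, substSignReflect_eq]

/-- The ratio `c = (u - x) / (1 - u x)` is inverted by `x ↦ 1 / x`. Of the resulting coefficients,
`(c⁻¹ - 1)(c - 1) + (c⁻¹ + 1)(c + 1) = 4` gives `f` and `(c⁻¹ + 1)(c - 1) + (c⁻¹ - 1)(c + 1) = 0`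
removes `ε_i f`. -/
theorem slashSimple_slashSimple_self (f : RatFun I) :
    slashSimple G i (slashSimple G i f) = f := by
  have hc : ∀ f, substReflect G i (substSign G i f) = substSign G i (substReflect G i f) :=
    fun f ↦ (substSign_substReflect_of_not_adj G (G.irrefl (v := i)) f).symm
  have h1 : substReflect G i (varX i) = (varX i)⁻¹ := by simp [substReflect_varX']
  have h2 : substSign G i (varX i) = varX i := by simp [substSign_varX]
  simp only [slashSimple_eq, map_add, map_mul, map_J, hc, substReflect_substReflect,
    substSign_substSign, h1, h2, substReflect_varU, substSign_varU, map_inv₀]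
  have hx := varX_ne_zero i
  have hd := one_sub_varU_mul_ne_zero (I := I) ⟨_, (rfl : varX i = _)⟩
  have hd' := varU_sub_varX_ne_zero i
  generalize (varX i : RatFun I) = x at *
  generalize (varU : RatFun I) = u at *
  have hd'' : 1 - u * x⁻¹ ≠ 0 := by
    rw [← div_eq_mul_inv, sub_ne_zero, Ne, eq_comm, div_eq_one_iff_eq hx]
    exact sub_ne_zero.mp hd'
  have hd3 : x - u ≠ 0 := by rw [← neg_sub]; exact neg_ne_zero.mpr hd'
  have hd4 : (u - x⁻¹) / (1 - u * x⁻¹) = (u * x - 1) / (x - u) := by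
    field_simp
  have e1 : J x⁻¹ u 0 * J x u 0 + J x⁻¹ u 1 * J x u 1 = 1 := by
    simp only [J, hd4]
    generalize hD : 1 - u * x = D at hd
    field_simp
    linear_combination (2 * (x - u)) * hD
  have e2 : J x⁻¹ u 1 * J x u 0 + J x⁻¹ u 0 * J x u 1 = 0 := by
    simp only [J, hd4]
    generalize hD : 1 - u * x = D at hd
    field_simp
    linear_combination (2 * (x - u)) * hD
  linear_combination f * e1 + substSign G i f * e2

theorem slashSimple_comm {i j : I} (hij : i ≠ j) (h : ¬ G.Adj i j) (f : RatFun I) :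
    slashSimple G i (slashSimple G j f) = slashSimple G j (slashSimple G i f) := by
  have hadj : ¬ G.Adj j i := fun h' ↦ h h'.symm
  have h1 : substReflect G i (varX j) = varX j := by simp [substReflect_varX', hij.symm, hadj]
  have h2 : substReflect G j (varX i) = varX i := by simp [substReflect_varX', hij, h]
  have h3 : substSign G i (varX j) = varX j := by simp [substSign_varX, hadj]
  have h4 : substSign G j (varX i) = varX i := by simp [substSign_varX, h]
  simp only [slashSimple_eq, map_add, map_mul, map_J, h1, h2, h3, h4, substReflect_varU,
    substSign_varU, substSign_comm G i j,
    substReflect_comm G hij h,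
    ← substSign_substReflect_of_not_adj G h, ← substSign_substReflect_of_not_adj G hadj]
  ring

theorem slashSimple_braid {i j : I} (h : G.Adj i j) (f : RatFun I) :
    slashSimple G i (slashSimple G j (slashSimple G i f)) =
      slashSimple G j (slashSimple G i (slashSimple G j f)) := by
  -- Moving all sign changes to the front leaves a combination of `g`, `ε_i g`, `ε_j g` and `ε_i ε_j
  -- g`, where `g` is the same for both sides by the braid relation of the substitutions. The
  -- coefficient of `g` is symmetric in `i` and `j`; the other three are matched by the identities
  -- for `J`.
  have key : ∀ {i j : I}, G.Adj i j → ∀ f : RatFun I,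
      slashSimple G i (slashSimple G j (slashSimple G i f)) =
      (let a := varX i
       let b := varX j
       let g := substReflect G i (substReflect G j (substReflect G i f))
       g * (J b varU 0 * J (a * b) varU 0 * J a varU 0 +
          J b varU 1 * J (-(a * b)) varU 1 * J a varU 1) +
       substSign G i g * (J (-b) varU 1 * J (a * b) varU 1 * J a varU 0 +
          J (-b) varU 0 * J (-(a * b)) varU 0 * J a varU 1) +
       substSign G j g * (J b varU 1 * J (a * b) varU 0 * J a varU 0 +
          J b varU 0 * J (-(a * b)) varU 1 * J a varU 1) +
       substSign G i (substSign G j g) * (J (-b) varU 0 * J (a * b) varU 1 * J a varU 0 +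
          J (-b) varU 1 * J (-(a * b)) varU 0 * J a varU 1)) := by
    intro i j h f
    have hij := h.ne
    have h1 : substReflect G j (varX i) = varX i * varX j := by
      simp [substReflect_varX', hij, h, mul_comm]
    have h2 : substReflect G i (varX j) = varX i * varX j := by
      simp [substReflect_varX', hij.symm, h.symm]
    have h3 : substSign G j (varX i) = -varX i := by simp [substSign_varX, h]
    have h4 : substSign G i (varX j) = -varX j := by simp [substSign_varX, h.symm]
    have h5 : substReflect G i (varX i) = (varX i)⁻¹ := by simp [substReflect_varX']
    have h6 : substSign G i (varX i) = varX i := by simp [substSign_varX]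
    have h7 : substSign G j (varX j) = varX j := by simp [substSign_varX]
    have h8 : (varX i : RatFun I)⁻¹ * (varX i * varX j) = varX j := by
      simp [varX_ne_zero]
    have hs : ∀ f, substReflect G i (substSign G i f) = substSign G i (substReflect G i f) :=
      fun f ↦ (substSign_substReflect_of_not_adj G (G.irrefl (v := i)) f).symm
    simp only [slashSimple_eq, map_add, map_mul, map_neg, map_J, h1, h2, h3, h4, h5, h6, h7, h8,
      hs, substReflect_varU, substSign_varU, substReflect_substSign_of_adj G h,
      substReflect_substSign_of_adj G h.symm, substSign_substSign, substSign_comm G j i,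
      neg_mul, mul_neg, neg_neg]
    ring
  rw [key h, key h.symm, substReflect_braid G h]
  have hn : ∀ p : Poly I, 1 - varU * algebraMap (Poly I) (RatFun I) p ≠ 0 :=
    fun p ↦ one_sub_varU_mul_ne_zero ⟨p, rfl⟩
  have hp : ∀ p : Poly I, 1 + varU * algebraMap (Poly I) (RatFun I) p ≠ 0 := fun p ↦ by
    simpa using hn (-p)
  have ha := hn (MvPolynomial.X (Sum.inl i))
  have ha' := hp (MvPolynomial.X (Sum.inl i))
  have hb := hn (MvPolynomial.X (Sum.inl j))
  have hb' := hp (MvPolynomial.X (Sum.inl j))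
  have hab := hn (MvPolynomial.X (Sum.inl i) * MvPolynomial.X (Sum.inl j))
  have hab' := hp (MvPolynomial.X (Sum.inl i) * MvPolynomial.X (Sum.inl j))
  rw [map_mul] at hab hab'
  have hba := hab
  have hba' := hab'
  rw [mul_comm (algebraMap _ _ _) (algebraMap _ _ _)] at hba hba'
  have e1 := J_braid_sign ha hb hb' hab hab'
  have e2 := J_braid_sign hb ha ha' hba hba'
  have e3 := J_braid_sign_sign ha ha' hb hb' hab hab'
  simp only [varX, substSign_comm G j i]
  set g := substReflect G j (substReflect G i (substReflect G j f))
  rw [mul_comm (algebraMap _ _ (MvPolynomial.X (Sum.inl j)))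
    (algebraMap _ _ (MvPolynomial.X (Sum.inl i)))] at *
  linear_combination substSign G i g * e1 - substSign G j g * e2 +
    substSign G i (substSign G j g) * e3

/-- The action of a simple reflection as an element of the opposite of the monoid of self-maps. -/
def slashOp (i : I) : (Function.End (RatFun I))ᵐᵒᵖ := MulOpposite.op (slashSimple G i)

theorem isLiftable_slashOp : (coxeterMatrix G).IsLiftable (slashOp G) :=
  isLiftable_coxeterMatrix G
    (fun i ↦ MulOpposite.unop_injective (funext fun f ↦ slashSimple_slashSimple_self G i f))
    (fun _ _ hij h ↦ MulOpposite.unop_injective (funext fun f ↦ (slashSimple_comm G hij h f).symm))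
    (fun _ _ h ↦ MulOpposite.unop_injective (funext fun f ↦ slashSimple_braid G h f))

/-- The Chinta-Gunnells action as a homomorphism on the group presented by the diagram. -/
def slashHom : (coxeterMatrix G).Group →* (Function.End (RatFun I))ᵐᵒᵖ :=
  (coxeterMatrix G).toCoxeterSystem.lift ⟨_, isLiftable_slashOp G⟩

/-- This gives well-definedness: the iterated action depends only on the group element, not on the
word. -/
theorem slashHom_wordProd (l : List I) (f : RatFun I) :
    (slashHom G ((coxeterMatrix G).toCoxeterSystem.wordProd l)).unop f = slashWord G l f := by
  induction l generalizing f with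
  | nil => simp [slashWord]; rfl
  | cons i l ih =>
    have h : slashHom G ((coxeterMatrix G).toCoxeterSystem.simple i) =
        slashOp G i :=
      (coxeterMatrix G).toCoxeterSystem.lift_apply_simple (isLiftable_slashOp G) i
    rw [CoxeterSystem.wordProd_cons, map_mul, MulOpposite.unop_mul, h]
    exact ih (slashSimple G i f)

theorem slashWord_append (l l' : List I) (f : RatFun I) :
    slashWord G (l ++ l') f = slashWord G l' (slashWord G l f) :=
  List.foldl_append

end RationalAction

/-! ### Monomials under the substitutions. -/

section Monomials

theorem prod_zpow_eq_zpow_sum {I F : Type*} [Field F] {s : Finset I} {x : F} (hx : x ≠ 0) (c : I → ℤ) :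
    ∏ i ∈ s, x ^ c i = x ^ ∑ i ∈ s, c i := by
  classical
  induction s using Finset.induction_on with
  | empty => simp
  | insert a s ha ih => rw [Finset.prod_insert ha, Finset.sum_insert ha, ih, zpow_add₀ hx]

variable {I : Type*} [Fintype I] {F : Type*} [Field F]

theorem monomial_add (x : I → F) (c d : I → ℤ) (h : ∀ i, d i = 0 ∨ x i ≠ 0) :
    monomial x (c + d) = monomial x c * monomial x d := by
  rw [monomial, monomial, monomial, ← Finset.prod_mul_distrib]
  refine Finset.prod_congr rfl fun i _ ↦ ?_
  rcases h i with h | h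
  · simp [h]
  · exact zpow_add₀ h _ _

/-- Coordinates may vanish in `Ω`, where exponents of mixed sign do not add; nonnegative ones always
do. -/
theorem monomial_add_of_nonneg (x : I → F) {c d : I → ℤ} (hc : 0 ≤ c) (hd : 0 ≤ d) :
    monomial x (c + d) = monomial x c * monomial x d := by
  rw [monomial, monomial, monomial, ← Finset.prod_mul_distrib]
  refine Finset.prod_congr rfl fun i _ ↦ ?_
  obtain ⟨m, hm⟩ := Int.eq_ofNat_of_zero_le (hc i)
  obtain ⟨n, hn⟩ := Int.eq_ofNat_of_zero_le (hd i)
  rw [Pi.add_apply, hm, hn, ← Nat.cast_add]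
  simp only [zpow_natCast, pow_add]

theorem monomial_nsmul (x : I → F) (n : ℕ) (c : I → ℤ) :
    monomial x (n • c) = monomial x c ^ n := by
  rw [monomial, monomial, ← Finset.prod_pow]
  refine Finset.prod_congr rfl fun i _ ↦ ?_
  rw [Pi.smul_apply, nsmul_eq_mul, mul_comm, zpow_mul, zpow_natCast]

theorem monomial_smul_single [DecidableEq I] (x : I → F) (i : I) (n : ℤ) :
    monomial x (n • Pi.single i 1) = x i ^ n := by
  rw [monomial, Finset.prod_eq_single i (fun j _ hj ↦ by simp [hj]) (by simp)]
  simp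

theorem map_monomial {F' : Type*} [Field F'] (φ : F →+* F') (x : I → F) (c : I → ℤ) :
    φ (monomial x c) = monomial (φ ∘ x) c := by
  simp [monomial, map_prod, map_zpow₀]

/-- The exponent of `x_i` becomes `-c_i + ∑_{j ∼ i} c_j = c_i - ∑_j c_j A_ji`, which is the action
of `σ_i` on the root lattice; so `x^β` goes to `x^{σ_i β}`. -/
theorem monomial_reflectVars [DecidableEq I] (G : SimpleGraph I) (A : Matrix I I ℤ) (hA : ∀ i, A i i = 2)
    (hadj : ∀ i j, G.Adj i j → A i j = -1) (hnadj : ∀ i j, i ≠ j → ¬ G.Adj i j → A i j = 0)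
    (i : I) {x : I → F} (hx : x i ≠ 0) (c : I → ℤ) :
    monomial (reflectVars G i x) c =
      monomial x (c - (∑ j, c j * A j i) • Pi.single i 1) := by
  rw [sub_eq_add_neg, ← neg_smul, monomial_add, monomial_smul_single, ← Finset.sum_neg_distrib,
    ← prod_zpow_eq_zpow_sum hx, monomial, monomial, ← Finset.prod_mul_distrib]
  · refine Finset.prod_congr rfl fun j _ ↦ ?_
    by_cases hj : j = i
    · subst hj
      rw [reflectVars, if_pos rfl, hA, ← zpow_add₀ hx, inv_zpow', show c j + -(c j * 2) = -c j by
        ring]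
    · by_cases hG : G.Adj j i
      · rw [reflectVars, if_neg hj, if_pos hG, hadj j i hG, mul_zpow, mul_comm]
        simp
      · rw [reflectVars, if_neg hj, if_neg hG, hnadj j i hj hG]
        simp
  · intro j
    by_cases hj : j = i
    · exact Or.inr (hj ▸ hx)
    · simp [hj]

theorem exists_monomial_signVars (G : SimpleGraph I) (i : I) (x : I → F) (c : I → ℤ) :
    ∃ s : ℤˣ, monomial (signVars G i x) c = ((s : ℤ) : F) * monomial x c := by
  have h : ∀ j, ∃ s : ℤˣ, signVars G i x j ^ c j = ((s : ℤ) : F) * x j ^ c j := by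
    intro j
    by_cases hG : G.Adj j i
    · rw [signVars, if_pos hG]
      rcases Int.even_or_odd (c j) with hc | hc
      · exact ⟨1, by rw [hc.neg_zpow]; simp⟩
      · exact ⟨-1, by rw [hc.neg_zpow]; simp⟩
    · rw [signVars, if_neg hG]
      exact ⟨1, by simp⟩
  choose s hs using h
  refine ⟨∏ j, s j, ?_⟩
  rw [monomial, Finset.prod_congr rfl fun j _ ↦ hs j, Finset.prod_mul_distrib, monomial]
  simp

end Monomials

/-! ### Inversion sets and the shape of `1|w`. -/

section Terms

open scoped Classical

variable {ι M N : Type*} [AddCommGroup M] [Module ℝ M] [AddCommGroup N] [Module ℝ N]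
  {P : RootPairing ι ℝ M N} {b : P.Base} {θ : ι}

theorem monomial_simpleRoot {F : Type*} [Field F] (i : Node b) (x : Node b → F) :
    monomial x (rootCoeff b θ (simpleRoot b θ i)) = x i := by
  rw [rootCoeff_simpleRoot]
  simpa using monomial_smul_single x i 1

/-- `g` is a product of factors `J(± x^β, u, ε)` indexed by the roots in `S`. -/
def IsJProd (b : P.Base) (θ : ι) (S : Finset (AffineRealRoot ι)) (g : RatFun (Node b)) : Prop :=
  ∃ (s : AffineRealRoot ι → ℤˣ) (e : AffineRealRoot ι → ℕ),
    g = ∏ β ∈ S, J (((s β : ℤ) : RatFun (Node b)) * monomial varX (rootCoeff b θ β)) varU (e β)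

/-- `f` is a sum of `2 ^ #S` products of factors `J(± x^β, u, ε)` indexed by the roots in `S`. -/
def IsJSum (b : P.Base) (θ : ι) (S : Finset (AffineRealRoot ι)) (f : RatFun (Node b)) : Prop :=
  ∃ T : Multiset (RatFun (Node b)), T.card = 2 ^ S.card ∧ (∀ g ∈ T, IsJProd b θ S g) ∧ f = T.sum

variable [P.IsCrystallographic]

/-- The substitution moves the index set by `σ_i`, and `J(x_i, u, e)` is the factor of `α_i`. Since
`-α_i ∉ S`, the root `α_i` is not in `σ_i S`, so the new factor does not collide with an old one. -/
theorem IsJProd.map_mul {S : Finset (AffineRealRoot ι)} {g : RatFun (Node b)}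
    (hg : IsJProd b θ S g) (i : Node b) (hi : negAffine P (simpleRoot b θ i) ∉ S)
    (φ : RatFun (Node b) →+* RatFun (Node b)) (hu : φ varU = varU)
    (hφ : ∀ β, ∃ s : ℤˣ, φ (monomial varX (rootCoeff b θ β)) = ((s : ℤ) : RatFun (Node b)) *
      monomial varX (rootCoeff b θ (reflectAffine P (simpleRoot b θ i) β))) (e : ℕ) :
    IsJProd b θ (insert (simpleRoot b θ i) (S.image (reflectAffine P (simpleRoot b θ i))))
      (φ g * J (varX i) varU e) := by
  obtain ⟨s, ε, rfl⟩ := hg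
  choose t ht using hφ
  set r := reflectAffine P (simpleRoot b θ i) with hr
  have hrr : ∀ β, r (r β) = β := reflectAffine_involutive _
  have hinj : Function.Injective r := (Function.Involutive.injective hrr)
  have hne : ∀ β ∈ S, r β ≠ simpleRoot b θ i := by
    rintro β hβ h
    apply hi
    rw [← reflectAffine_self, ← hr, ← h, hrr]
    exact hβ
  have hni : simpleRoot b θ i ∉ S.image r := by
    rw [Finset.mem_image]
    rintro ⟨β, hβ, h⟩
    exact hne β hβ h
  -- Signs and exponents are transported along `σ_i` and overridden at `α_i`.
  refine ⟨Function.update (fun β ↦ s (r β) * t (r β)) (simpleRoot b θ i) 1,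
    Function.update (fun β ↦ ε (r β)) (simpleRoot b θ i) e, ?_⟩
  rw [Finset.prod_insert hni, Finset.prod_image hinj.injOn, mul_comm, map_prod]
  congr 1
  · simp [monomial_simpleRoot]
  · refine Finset.prod_congr rfl fun β hβ ↦ ?_
    rw [map_J, _root_.map_mul, map_intCast, ht, hu, Function.update_of_ne (hne β hβ),
      Function.update_of_ne (hne β hβ), hrr, Units.val_mul, Int.cast_mul, mul_assoc]

variable [Finite ι] (hsl : (affineCartan b θ).IsSimplyLaced)

theorem monomial_reflectVars_rootCoeff {F : Type*} [Field F]
    (hsl : (affineCartan b θ).IsSimplyLaced) (i : Node b) {x : Node b → F} (hx : x i ≠ 0)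
    (β : AffineRealRoot ι) :
    monomial (reflectVars (dynkin b θ) i x) (rootCoeff b θ β) =
      monomial x (rootCoeff b θ (reflectAffine P (simpleRoot b θ i) β)) := by
  rw [monomial_reflectVars _ (affineCartan b θ) affineCartan_self
    (fun _ _ ↦ affineCartan_eq_neg_one_of_adj hsl)
    (fun _ _ ↦ affineCartan_eq_zero_of_not_adj) i hx, rootCoeff_reflectAffine, pairingIn_eq_sum]

theorem monomial_reflectVars_deltaCoeff {F : Type*} [Field F]
    (hsl : (affineCartan b θ).IsSimplyLaced) (i : Node b) {x : Node b → F} (hx : x i ≠ 0) :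
    monomial (reflectVars (dynkin b θ) i x) (deltaCoeff b θ) = monomial x (deltaCoeff b θ) := by
  rw [monomial_reflectVars _ (affineCartan b θ) affineCartan_self
    (fun _ _ ↦ affineCartan_eq_neg_one_of_adj hsl)
    (fun _ _ ↦ affineCartan_eq_zero_of_not_adj) i hx, sum_deltaCoeff_mul_affineCartan]
  simp

theorem wordProd_eq_iff (hsl : (affineCartan b θ).IsSimplyLaced) (hθ : IsHighestRoot b θ) {l l' : List (Node b)} :
    wordProd b θ l = wordProd b θ l' ↔
      (diagramSystem b θ).wordProd l = (diagramSystem b θ).wordProd l' := by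
  rw [← toAffineWeylGroup_wordProd hsl, ← toAffineWeylGroup_wordProd hsl,
    (toAffineWeylGroup_injective hsl hθ).eq_iff]

/-- The word chosen in `slash` is immaterial: words with equal product in the affine Weyl group are
already equal in the presented group, through which the action factors. -/
theorem slash_wordProd (hsl : (affineCartan b θ).IsSimplyLaced) (hθ : IsHighestRoot b θ)
    (l : List (Node b)) (f : RatFun (Node b)) :
    slash b θ (wordProd b θ l) f = slashWord (dynkin b θ) l f := by
  have h : ∃ l', wordProd b θ l' = wordProd b θ l := ⟨l, rfl⟩
  have h' := (wordProd_eq_iff hsl hθ).mp h.choose_spec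
  rw [slash, dif_pos h, ← slashHom_wordProd, ← slashHom_wordProd]
  exact congrArg (fun w ↦ (slashHom (dynkin b θ) w).unop f) h'

theorem exists_wordProd_eq [P.IsReduced] (hsl : (affineCartan b θ).IsSimplyLaced)
    (hθ : IsHighestRoot b θ) (w : affineWeylGroup P) : ∃ l, wordProd b θ l = w := by
  obtain ⟨v, rfl⟩ := toAffineWeylGroup_surjective hsl hθ w
  obtain ⟨l, rfl⟩ := (diagramSystem b θ).wordProd_surjective v
  exact ⟨l, (toAffineWeylGroup_wordProd hsl l).symm⟩

theorem slash_mul [P.IsReduced] (hsl : (affineCartan b θ).IsSimplyLaced)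
    (hθ : IsHighestRoot b θ) (w w' : affineWeylGroup P) (f : RatFun (Node b)) :
    slash b θ (w * w') f = slash b θ w' (slash b θ w f) := by
  obtain ⟨l, rfl⟩ := exists_wordProd_eq hsl hθ w
  obtain ⟨l', rfl⟩ := exists_wordProd_eq hsl hθ w'
  have : wordProd b θ l * wordProd b θ l' = wordProd b θ (l ++ l') := by simp [wordProd]
  rw [this, slash_wordProd hsl hθ, slash_wordProd hsl hθ, slash_wordProd hsl hθ, slashWord_append]

theorem slash_simpleReflection (hsl : (affineCartan b θ).IsSimplyLaced) (hθ : IsHighestRoot b θ)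
    (i : Node b) (f : RatFun (Node b)) :
    slash b θ (simpleReflection b θ i) f = slashSimple (dynkin b θ) i f := by
  have : simpleReflection b θ i = wordProd b θ [i] := by simp [wordProd]
  rw [this, slash_wordProd hsl hθ]
  rfl

/-- The roots in `S` are the positive affine real roots that `w` maps to negative ones. -/
def IsInversionSet (hsl : (affineCartan b θ).IsSimplyLaced) (w : DiagramGroup b θ)
    (S : Finset (AffineRealRoot ι)) : Prop :=
  ∀ β, β ∈ S ↔ IsPositive b β ∧ ¬ IsPositive b (rootAction hsl w β)

theorem rootAction_negAffine (w : DiagramGroup b θ) (β : AffineRealRoot ι) :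
    rootAction hsl w (negAffine P β) = negAffine P (rootAction hsl w β) := by
  obtain ⟨T, hT⟩ := exists_linear_rootAction hsl w
  apply rootCoeff_injective (b := b) (θ := θ)
  rw [hT, rootCoeff_negAffine, rootCoeff_negAffine, hT, map_neg]

/-- An element of the group is determined by its inversion set. -/
theorem IsInversionSet.unique (hθ : IsHighestRoot b θ) {v w : DiagramGroup b θ}
    {S : Finset (AffineRealRoot ι)} (hv : IsInversionSet hsl v S) (hw : IsInversionSet hsl w S) :
    v = w := by
  rw [← mul_inv_eq_one]
  refine eq_one_of_forall_isPositive hsl hθ fun i ↦ ?_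
  set γ := simpleRoot b θ i
  have hγ : IsPositive b γ := isPositive_simpleRoot hθ i
  -- With `β = w⁻¹ α_i` the goal is `v β > 0`. If `β > 0`, it is not an inversion of `w`, hence not
  -- of `v`; if `β < 0`, then `-β` is an inversion of `w`, hence of `v`.
  obtain ⟨β, hβ⟩ : ∃ β, β = rootAction hsl w⁻¹ γ := ⟨_, rfl⟩
  have hwβ : rootAction hsl w β = γ := by
    rw [hβ, ← Equiv.Perm.mul_apply, ← map_mul, mul_inv_cancel, map_one, Equiv.Perm.one_apply]
  rw [map_mul, Equiv.Perm.mul_apply, ← hβ]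
  by_cases hp : IsPositive b β
  · by_contra hn
    exact ((hw β).mp ((hv β).mpr ⟨hp, hn⟩)).2 (hwβ ▸ hγ)
  · have hp' := (isPositive_negAffine β).mpr hp
    have h1 : negAffine P β ∈ S := by
      rw [hw, rootAction_negAffine, hwβ, isPositive_negAffine (b := b) γ, not_not]
      exact ⟨hp', hγ⟩
    have h2 := ((hv _).mp h1).2
    rwa [rootAction_negAffine, isPositive_negAffine, not_not] at h2

/-- Both summands of `f|σ_i` send a product over `S` to a product over `{α_i} ∪ σ_i S`, so the
number of products doubles as the index set gains one root. -/
theorem IsJSum.slashSimple {S : Finset (AffineRealRoot ι)} {f : RatFun (Node b)}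
    (hf : IsJSum b θ S f) (hsl : (affineCartan b θ).IsSimplyLaced) (i : Node b)
    (hi : negAffine P (simpleRoot b θ i) ∉ S) :
    IsJSum b θ (insert (simpleRoot b θ i) (S.image (reflectAffine P (simpleRoot b θ i))))
      (slashSimple (dynkin b θ) i f) := by
  obtain ⟨T, hcard, hT, rfl⟩ := hf
  have hφ : ∀ β, substReflect (dynkin b θ) i (monomial varX (rootCoeff b θ β)) =
      monomial varX (rootCoeff b θ (reflectAffine P (simpleRoot b θ i) β)) := fun β ↦ by
    rw [map_monomial, ← monomial_reflectVars_rootCoeff hsl i (varX_ne_zero i)]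
    exact congrArg (fun y ↦ monomial y _) (funext fun j ↦ substReflect_varX _ i j)
  have hφ' : ∀ β, ∃ s : ℤˣ, substSignReflect (dynkin b θ) i (monomial varX (rootCoeff b θ β)) =
      ((s : ℤ) : RatFun (Node b)) *
        monomial varX (rootCoeff b θ (reflectAffine P (simpleRoot b θ i) β)) := fun β ↦ by
    rw [map_monomial, ← monomial_reflectVars_rootCoeff hsl i (varX_ne_zero i)]
    have : substSignReflect (dynkin b θ) i ∘ varX =
        signVars (dynkin b θ) i (reflectVars (dynkin b θ) i varX) :=
      funext fun j ↦ substSignReflect_varX _ i j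
    rw [this]
    exact exists_monomial_signVars _ _ _ _
  refine ⟨T.map (fun g ↦ substReflect (dynkin b θ) i g * J (varX i) varU 0) +
    T.map (fun g ↦ substSignReflect (dynkin b θ) i g * J (varX i) varU 1), ?_, ?_, ?_⟩
  · have hinj : Function.Injective (reflectAffine P (simpleRoot b θ i)) :=
      Function.Involutive.injective (reflectAffine_involutive _)
    have hni : simpleRoot b θ i ∉ S.image (reflectAffine P (simpleRoot b θ i)) := by
      rw [Finset.mem_image]
      rintro ⟨β, hβ, h⟩
      apply hi
      rwa [← reflectAffine_self, ← congrArg (reflectAffine P (simpleRoot b θ i)) h, reflectAffine_involutive]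
    rw [Finset.card_insert_of_notMem hni, Finset.card_image_of_injective _ hinj]
    simp [hcard]
    ring
  · intro g hg
    rw [Multiset.mem_add, Multiset.mem_map, Multiset.mem_map] at hg
    rcases hg with ⟨g, hg, rfl⟩ | ⟨g, hg, rfl⟩
    · exact (hT g hg).map_mul i hi _ (substReflect_varU _ _)
        (fun β ↦ ⟨1, by rw [hφ]; simp⟩) 0
    · exact (hT g hg).map_mul i hi _ (substSignReflect_varU _ _) hφ' 1
  · rw [Multiset.sum_add, Multiset.sum_map_mul_right, Multiset.sum_map_mul_right,
      ChintaGunnells.slashSimple, map_multiset_sum, map_multiset_sum]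

/-- The inversion set of `w` is finite, and `1|w` is a sum of products of factors indexed by it. -/
theorem exists_isInversionSet_isJSum [P.IsReduced] (hθ : IsHighestRoot b θ)
    (w : DiagramGroup b θ) : ∃ S : Finset (AffineRealRoot ι), IsInversionSet hsl w S ∧
      IsJSum b θ S ((slashHom (dynkin b θ) w).unop 1) := by
  obtain ⟨n, hn⟩ : ∃ n, (diagramSystem b θ).length w = n := ⟨_, rfl⟩
  induction n generalizing w with
  | zero =>
    obtain rfl := (diagramSystem b θ).length_eq_zero_iff.mp hn
    refine ⟨∅, fun β ↦ by simp, {1}, by simp, ?_, ?_⟩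
    · intro g hg
      rw [Multiset.mem_singleton] at hg
      exact ⟨1, 0, by simp [hg]⟩
    · rw [map_one, Multiset.sum_singleton]
      rfl
  | succ n ih =>
    have hw1 : w ≠ 1 := by
      rintro rfl
      simp at hn
    obtain ⟨i, hi⟩ := (diagramSystem b θ).exists_rightDescent_of_ne_one hw1
    have hlen := (diagramSystem b θ).isRightDescent_iff.mp hi
    obtain ⟨v, hv⟩ : ∃ v, v = w * (diagramSystem b θ).simple i := ⟨_, rfl⟩
    have hwv : w = v * (diagramSystem b θ).simple i := by
      rw [hv, CoxeterSystem.simple_mul_simple_cancel_right]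
    rw [← hv] at hlen
    obtain ⟨S, hS, hsum⟩ := ih v (by omega)
    have hvi : IsPositive b (rootAction hsl v (simpleRoot b θ i)) := by
      rw [isPositive_rootAction_iff hsl hθ, CoxeterSystem.not_isRightDescent_iff, ← hwv]
      omega
    have hpos := isPositive_simpleRoot hθ i
    -- As `v α_i > 0` and `σ_i` permutes the positive roots other than `α_i`, the inversions of `v
    -- σ_i` are `α_i` and the `σ_i`-images of those of `v`.
    refine ⟨insert (simpleRoot b θ i) (S.image (reflectAffine P (simpleRoot b θ i))), ?_, ?_⟩
    · intro β
      rw [hwv, rootAction_mul_simple_apply, Finset.mem_insert, Finset.mem_image]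
      constructor
      · rintro (rfl | ⟨γ, hγ, rfl⟩)
        · refine ⟨hpos, ?_⟩
          rwa [reflectAffine_self, rootAction_negAffine, isPositive_negAffine, not_not]
        · rw [reflectAffine_involutive]
          obtain ⟨h1, h2⟩ := (hS γ).mp hγ
          refine ⟨isPositive_reflectAffine hθ h1 ?_, h2⟩
          rintro rfl
          exact h2 hvi
      · rintro ⟨h1, h2⟩
        by_cases hβ : β = simpleRoot b θ i
        · exact Or.inl hβ
        · refine Or.inr ⟨reflectAffine P (simpleRoot b θ i) β, (hS _).mpr ⟨?_, h2⟩,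
            reflectAffine_involutive _ _⟩
          exact isPositive_reflectAffine hθ h1 hβ
    · have h1 : (slashHom (dynkin b θ) w).unop 1 =
          slashSimple (dynkin b θ) i ((slashHom (dynkin b θ) v).unop 1) := by
        rw [hwv, _root_.map_mul, MulOpposite.unop_mul]
        have h : slashHom (dynkin b θ) ((diagramSystem b θ).simple i) = slashOp (dynkin b θ) i :=
          (coxeterMatrix (dynkin b θ)).toCoxeterSystem.lift_apply_simple
            (isLiftable_slashOp (dynkin b θ)) i
        rw [h]
        rfl
      rw [h1]
      refine hsum.slashSimple hsl i fun hmem ↦ ?_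
      exact (isPositive_negAffine _).mp ((hS _).mp hmem).1 hpos

end Terms

/-! ### Regularity and values of rational functions at a point. -/

section Values

variable {I : Type*} {f g : RatFun I} {z : Point I} {v w : ℂ}

/-- The rational function `f` is regular at `z`, with value `v`. -/
def HasValue (f : RatFun I) (z : Point I) (v : ℂ) : Prop :=
  ∃ p q : Poly I, MvPolynomial.eval (Sum.elim z.1 fun _ ↦ z.2) q ≠ 0 ∧
    f = algebraMap (Poly I) (RatFun I) p / algebraMap (Poly I) (RatFun I) q ∧
    v = MvPolynomial.eval (Sum.elim z.1 fun _ ↦ z.2) p /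
      MvPolynomial.eval (Sum.elim z.1 fun _ ↦ z.2) q

theorem algebraMap_ne_zero_of_eval_ne_zero {q : Poly I} {y : I ⊕ Unit → ℂ}
    (h : MvPolynomial.eval y q ≠ 0) : algebraMap (Poly I) (RatFun I) q ≠ 0 := by
  rw [Ne, IsFractionRing.to_map_eq_zero_iff]
  rintro rfl
  simp at h

/-- Any fraction with nonvanishing denominator suffices, which makes regularity stable under field
operations: the reduced denominator divides every other one, as it is coprime to the reduced
numerator. -/
theorem HasValue.isRegularAt_and_value_eq (h : HasValue f z v) :
    IsRegularAt f z ∧ value f z = v := by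
  obtain ⟨p, q, hq, rfl, rfl⟩ := h
  set f := algebraMap (Poly I) (RatFun I) p / algebraMap (Poly I) (RatFun I) q with hf
  set n := IsFractionRing.num (Poly I) f
  set d := (IsFractionRing.den (Poly I) f : Poly I) with hd
  have hd0 : algebraMap (Poly I) (RatFun I) d ≠ 0 := by
    rw [Ne, IsFractionRing.to_map_eq_zero_iff]
    exact nonZeroDivisors.coe_ne_zero _
  have hnd : n * q = p * d := by
    apply IsFractionRing.injective (Poly I) (RatFun I)
    have h1 : algebraMap (Poly I) (RatFun I) n / algebraMap (Poly I) (RatFun I) d = f :=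
      IsFractionRing.mk'_num_den' (Poly I) f
    rw [hf, div_eq_div_iff hd0 (algebraMap_ne_zero_of_eval_ne_zero hq)] at h1
    rwa [map_mul, map_mul]
  have hdvd : d ∣ q :=
    (IsFractionRing.num_den_reduced (Poly I) f).symm.dvd_of_dvd_mul_left
      (hnd ▸ dvd_mul_left d p)
  have hreg : MvPolynomial.eval (Sum.elim z.1 fun _ ↦ z.2) d ≠ 0 := by
    obtain ⟨r, hr⟩ := hdvd
    intro h0
    rw [hr, map_mul, h0, zero_mul] at hq
    exact hq rfl
  refine ⟨hreg, ?_⟩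
  rw [value, div_eq_div_iff hreg hq, ← map_mul, ← map_mul]
  exact congrArg _ hnd

theorem HasValue.isRegularAt (h : HasValue f z v) : IsRegularAt f z :=
  h.isRegularAt_and_value_eq.1

theorem HasValue.value_eq (h : HasValue f z v) : value f z = v :=
  h.isRegularAt_and_value_eq.2

theorem IsRegularAt.hasValue (h : IsRegularAt f z) : HasValue f z (value f z) :=
  ⟨_, _, h, (IsFractionRing.mk'_num_den' (Poly I) f).symm, rfl⟩

theorem hasValue_algebraMap (p : Poly I) (z : Point I) :
    HasValue (algebraMap (Poly I) (RatFun I) p) z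
      (MvPolynomial.eval (Sum.elim z.1 fun _ ↦ z.2) p) :=
  ⟨p, 1, by simp, by simp, by simp⟩

theorem hasValue_one (z : Point I) : HasValue 1 z 1 := by
  simpa using hasValue_algebraMap 1 z

theorem hasValue_varX (i : I) (z : Point I) : HasValue (varX i) z (z.1 i) := by
  have h := hasValue_algebraMap (MvPolynomial.X (Sum.inl i)) z
  rw [MvPolynomial.eval_X] at h
  exact h

theorem hasValue_varU (z : Point I) : HasValue varU z z.2 := by
  have h := hasValue_algebraMap (MvPolynomial.X (Sum.inr ())) z
  rw [MvPolynomial.eval_X] at h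
  exact h

theorem hasValue_C (c : ℂ) (z : Point I) : HasValue (algebraMap ℂ (RatFun I) c) z c := by
  have h := hasValue_algebraMap (MvPolynomial.C c) z
  rw [MvPolynomial.eval_C] at h
  exact h

theorem hasValue_intCast (n : ℤ) (z : Point I) : HasValue (n : RatFun I) z n := by
  simpa using hasValue_algebraMap (n : Poly I) z

theorem HasValue.add (hf : HasValue f z v) (hg : HasValue g z w) : HasValue (f + g) z (v + w) := by
  obtain ⟨p, q, hq, rfl, rfl⟩ := hf
  obtain ⟨p', q', hq', rfl, rfl⟩ := hg
  refine ⟨p * q' + q * p', q * q', by simp [hq, hq'], ?_, ?_⟩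
  · rw [div_add_div _ _ (algebraMap_ne_zero_of_eval_ne_zero hq)
      (algebraMap_ne_zero_of_eval_ne_zero hq')]
    simp
  · rw [div_add_div _ _ hq hq']
    simp

theorem HasValue.mul (hf : HasValue f z v) (hg : HasValue g z w) : HasValue (f * g) z (v * w) := by
  obtain ⟨p, q, hq, rfl, rfl⟩ := hf
  obtain ⟨p', q', hq', rfl, rfl⟩ := hg
  refine ⟨p * p', q * q', by simp [hq, hq'], ?_, ?_⟩
  · rw [div_mul_div_comm]
    simp
  · rw [div_mul_div_comm]
    simp

theorem HasValue.inv (hf : HasValue f z v) (hv : v ≠ 0) : HasValue f⁻¹ z v⁻¹ := by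
  obtain ⟨p, q, hq, rfl, rfl⟩ := hf
  exact ⟨q, p, fun h ↦ hv (by rw [h, zero_div]), inv_div _ _, inv_div _ _⟩

theorem HasValue.neg (hf : HasValue f z v) : HasValue (-f) z (-v) := by
  simpa using (hasValue_intCast (-1) z).mul hf

theorem HasValue.sub (hf : HasValue f z v) (hg : HasValue g z w) : HasValue (f - g) z (v - w) := by
  simpa [sub_eq_add_neg] using hf.add hg.neg

theorem HasValue.div (hf : HasValue f z v) (hg : HasValue g z w) (hw : w ≠ 0) :
    HasValue (f / g) z (v / w) := by
  simpa [div_eq_mul_inv] using hf.mul (hg.inv hw)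

theorem HasValue.pow (hf : HasValue f z v) (n : ℕ) : HasValue (f ^ n) z (v ^ n) := by
  induction n with
  | zero => simpa using hasValue_one z
  | succ n ih => simpa [pow_succ] using ih.mul hf

theorem HasValue.prod {A : Type*} {s : Finset A} {f : A → RatFun I} {v : A → ℂ}
    (h : ∀ a ∈ s, HasValue (f a) z (v a)) : HasValue (∏ a ∈ s, f a) z (∏ a ∈ s, v a) := by
  classical
  induction s using Finset.induction_on with
  | empty => simpa using hasValue_one z
  | insert a s ha ih =>
    rw [Finset.prod_insert ha, Finset.prod_insert ha]
    exact (h a (Finset.mem_insert_self a s)).mul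
      (ih fun a' ha' ↦ h a' (Finset.mem_insert_of_mem ha'))

theorem HasValue.J (hf : HasValue f z v) (h : 1 - z.2 * v ≠ 0) (e : ℕ) :
    HasValue (J f varU e) z (J v z.2 e) := by
  have h2 : HasValue (2 : RatFun I) z 2 := by simpa using hasValue_intCast 2 z
  have h1 : HasValue ((-1 : RatFun I) ^ e) z ((-1) ^ e) := (hasValue_one z).neg.pow e
  have hu := hasValue_varU z
  exact (hf.div h2 two_ne_zero).mul (((hu.sub hf).div ((hasValue_one z).sub (hu.mul hf)) h).sub h1)

theorem hasValue_monomial [Fintype I] {c : I → ℤ} (hc : 0 ≤ c) (z : Point I) :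
    HasValue (monomial varX c) z (monomial z.1 c) := by
  refine HasValue.prod fun i _ ↦ ?_
  obtain ⟨n, hn⟩ := Int.eq_ofNat_of_zero_le (hc i)
  rw [hn]
  simpa using (hasValue_varX i z).pow n

theorem HasValue.substPoly {y : I → RatFun I} {z z' : Point I} (hz : z'.2 = z.2)
    (hy : ∀ i, HasValue (y i) z (z'.1 i)) (p : Poly I) :
    HasValue (substPoly y p) z (MvPolynomial.eval (Sum.elim z'.1 fun _ ↦ z'.2) p) := by
  induction p using MvPolynomial.induction_on with
  | C c =>
    rw [MvPolynomial.eval_C, ChintaGunnells.substPoly, MvPolynomial.aeval_C]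
    exact hasValue_C c z
  | add p q hp hq => simpa using hp.add hq
  | mul_X p i hp =>
    rw [map_mul, map_mul, MvPolynomial.eval_X]
    refine hp.mul ?_
    rcases i with i | ⟨⟩
    · simpa [ChintaGunnells.substPoly] using hy i
    · simpa [ChintaGunnells.substPoly, hz] using hasValue_varU z

theorem HasValue.map {φ : RatFun I →+* RatFun I} {y : I → RatFun I} {z z' : Point I}
    (hφ : ∀ p, φ (algebraMap (Poly I) (RatFun I) p) = ChintaGunnells.substPoly y p)
    (hz : z'.2 = z.2) (hy : ∀ i, HasValue (y i) z (z'.1 i)) (hf : HasValue f z' v) :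
    HasValue (φ f) z v := by
  obtain ⟨p, q, hq, rfl, rfl⟩ := hf
  rw [map_div₀, hφ, hφ]
  exact (HasValue.substPoly hz hy p).div (HasValue.substPoly hz hy q) hq

theorem hasValue_reflectVars (G : SimpleGraph I) (i : I) (hz : z.1 i ≠ 0) (j : I) :
    HasValue (reflectVars G i varX j) z (reflectVars G i z.1 j) := by
  unfold reflectVars
  split_ifs with h1 h2
  · subst h1; exact (hasValue_varX j z).inv hz
  · exact (hasValue_varX i z).mul (hasValue_varX j z)
  · exact hasValue_varX j z

theorem HasValue.substReflect (G : SimpleGraph I) (i : I) (hz : z.1 i ≠ 0)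
    (hf : HasValue f (reflectVars G i z.1, z.2) v) : HasValue (substReflect G i f) z v :=
  HasValue.map (z' := (reflectVars G i z.1, z.2)) (substReflect_algebraMap G i) rfl
    (hasValue_reflectVars G i hz) hf

theorem HasValue.substSignReflect (G : SimpleGraph I) (i : I) (hz : z.1 i ≠ 0)
    (hf : HasValue f (signVars G i (reflectVars G i z.1), z.2) v) :
    HasValue (substSignReflect G i f) z v := by
  refine HasValue.map (z' := (signVars G i (reflectVars G i z.1), z.2))
    (substSignReflect_algebraMap G i) rfl (fun j ↦ ?_) hf
  have h := hasValue_reflectVars G i hz j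
  simp only [signVars]
  split_ifs
  · exact h.neg
  · exact h

theorem HasValue.slashSimple (G : SimpleGraph I) (i : I) (hz : z.1 i ≠ 0)
    (hu : 1 - z.2 * z.1 i ≠ 0) (hf : HasValue f (reflectVars G i z.1, z.2) v)
    (hf' : HasValue f (signVars G i (reflectVars G i z.1), z.2) w) :
    HasValue (slashSimple G i f) z
      (v * ChintaGunnells.J (z.1 i) z.2 0 + w * ChintaGunnells.J (z.1 i) z.2 1) :=
  ((hf.substReflect G i hz).mul ((hasValue_varX i z).J hu 0)).add
    ((hf'.substSignReflect G i hz).mul ((hasValue_varX i z).J hu 1))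

end Values

/-! ### Convergence and invariance of the average. -/

section Bounds

variable {ι M N : Type*} [AddCommGroup M] [Module ℝ M] [AddCommGroup N] [Module ℝ N]
  {P : RootPairing ι ℝ M N} {b : P.Base} {θ : ι}

/-- The number `2^#S` of products is absorbed by doubling each factor, so the bound remains a
product over `S`. -/
theorem IsJSum.exists_hasValue (hθ : IsHighestRoot b θ) {S : Finset (AffineRealRoot ι)}
    (hS : ∀ β ∈ S, IsPositive b β) {f : RatFun (Node b)} (hf : IsJSum b θ S f)
    {z : Point (Node b)} (hz : z ∈ region b θ) {a : AffineRealRoot ι → ℝ}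
    (ha : ∀ β ∈ S, ∀ (s : ℤˣ) (e : ℕ),
      ‖J (((s : ℤ) : ℂ) * monomial z.1 (rootCoeff b θ β)) z.2 e‖ ≤ a β) :
    ∃ v, HasValue f z v ∧ ‖v‖ ≤ ∏ β ∈ S, 2 * a β := by
  obtain ⟨T, hcard, hT, rfl⟩ := hf
  have hprod : ∀ g ∈ T, ∃ v, HasValue g z v ∧ ‖v‖ ≤ ∏ β ∈ S, a β := by
    intro g hg
    obtain ⟨s, e, rfl⟩ := hT g hg
    refine ⟨∏ β ∈ S, J (((s β : ℤ) : ℂ) * monomial z.1 (rootCoeff b θ β)) z.2 (e β),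
      HasValue.prod fun β hβ ↦ ?_, ?_⟩
    · refine ((hasValue_intCast _ z).mul
        (hasValue_monomial (rootCoeff_nonneg hθ (hS β hβ)) z)).J ?_ _
      obtain ⟨h1, h2⟩ := hz.2 β (hS β hβ)
      rcases Int.units_eq_one_or (s β) with h | h
      · rw [h, sub_ne_zero]
        simpa using h1.symm
      · rw [h, sub_ne_zero]
        simp only [Units.val_neg, Units.val_one, Int.cast_neg, Int.cast_one, neg_mul, one_mul,
          mul_neg]
        exact fun h ↦ h2 (by rw [← neg_neg (z.2 * _), ← h])
    · rw [norm_prod]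
      exact Finset.prod_le_prod (fun _ _ ↦ norm_nonneg _) fun β hβ ↦ ha β hβ _ _
  have hsum : ∀ T : Multiset (RatFun (Node b)),
      (∀ g ∈ T, ∃ v, HasValue g z v ∧ ‖v‖ ≤ ∏ β ∈ S, a β) →
      ∃ v, HasValue T.sum z v ∧ ‖v‖ ≤ T.card * ∏ β ∈ S, a β := by
    intro T
    induction T using Multiset.induction_on with
    | empty => exact fun _ ↦ ⟨0, by simpa using hasValue_intCast 0 z, by simp⟩
    | cons g T ih =>
      intro h
      obtain ⟨v, hv, hv'⟩ := ih fun g' hg' ↦ h g' (Multiset.mem_cons_of_mem hg')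
      obtain ⟨w, hw, hw'⟩ := h g (Multiset.mem_cons_self g T)
      refine ⟨w + v, by rw [Multiset.sum_cons]; exact hw.add hv, (norm_add_le _ _).trans ?_⟩
      rw [Multiset.card_cons]
      push_cast
      linarith
  obtain ⟨v, hv, hv'⟩ := hsum T hprod
  refine ⟨v, hv, ?_⟩
  rw [Finset.prod_mul_distrib, Finset.prod_const]
  rw [hcard] at hv'
  exact_mod_cast hv'

theorem exists_pos_le_of_isCompact {X : Type*} [TopologicalSpace X] {K : Set X} (hK : IsCompact K)
    {f : X → ℝ} (hf : Continuous f) (hpos : ∀ z ∈ K, 0 < f z) :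
    ∃ d : ℝ, 0 < d ∧ ∀ z ∈ K, d ≤ f z :=
  hK.exists_forall_le' hf.continuousOn hpos

theorem exists_norm_le_of_isCompact {X : Type*} [TopologicalSpace X] {K : Set X} (hK : IsCompact K)
    {f : X → ℂ} (hf : Continuous f) : ∃ C : ℝ, ∀ z ∈ K, ‖f z‖ ≤ C :=
  hK.exists_bound_of_continuousOn hf.continuousOn

theorem continuous_monomial {I : Type*} [Fintype I] {c : I → ℤ} (hc : 0 ≤ c) :
    Continuous fun z : Point I ↦ monomial z.1 c := by
  refine continuous_finsetProd _ fun i _ ↦ ?_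
  obtain ⟨n, hn⟩ := Int.eq_ofNat_of_zero_le (hc i)
  simp only [hn]
  have : Continuous fun z : Point I ↦ z.1 i := (continuous_apply i).comp continuous_fst
  simp only [zpow_natCast]
  exact this.pow n

theorem summable_pow_natAbs [Finite ι] {q : ℝ} (hq0 : 0 ≤ q) (hq1 : q < 1) :
    Summable fun β : AffineRealRoot ι ↦ q ^ β.2.natAbs := by
  have h1 : Summable fun n : ℤ ↦ q ^ n.natAbs :=
    Summable.of_nat_of_neg (by simpa using summable_geometric_of_lt_one hq0 hq1)
      (by simpa using summable_geometric_of_lt_one hq0 hq1)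
  have h2 : Summable fun _ : ι ↦ (1 : ℝ) := Summable.of_finite
  simpa using h2.mul_of_nonneg h1 (fun _ ↦ zero_le_one) fun _ ↦ pow_nonneg hq0 _

/-- The monomials of the positive affine real roots decay geometrically on compact sets. -/
theorem exists_norm_monomial_le [Finite ι] (hθ : IsHighestRoot b θ) {K : Set (Point (Node b))}
    (hK : K ⊆ region b θ) (hKc : IsCompact K) :
    ∃ C q : ℝ, 0 ≤ C ∧ 0 < q ∧ q < 1 ∧ ∀ z ∈ K, ∀ β : AffineRealRoot ι, IsPositive b β →
      ‖monomial z.1 (rootCoeff b θ β)‖ ≤ C * q ^ β.2.natAbs := by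
  classical
  have hδ := deltaCoeff_nonneg hθ
  obtain ⟨q, hq0, hq1, hq⟩ : ∃ q : ℝ, 0 < q ∧ q < 1 ∧
      ∀ z ∈ K, ‖monomial z.1 (deltaCoeff b θ)‖ ≤ q := by
    have hcont : Continuous fun z : Point (Node b) ↦ 1 - ‖monomial z.1 (deltaCoeff b θ)‖ :=
      continuous_const.sub (continuous_monomial hδ).norm
    obtain ⟨d, hd, hd'⟩ := exists_pos_le_of_isCompact hKc hcont fun z hz ↦ sub_pos.mpr (hK hz).1
    -- `1 - d` need not be positive, and `q` is divided by below.
    refine ⟨max (1 - d) (1 / 2), by positivity, max_lt (by linarith) (by norm_num),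
      fun z hz ↦ le_max_of_le_left ?_⟩
    linarith [hd' z hz]
  let e : ι → ℤ := fun k ↦ if b.IsPos k then 0 else 1
  have he : ∀ k, IsPositive b (k, e k) := fun k ↦ le_rfl
  have hC : ∀ k, ∃ C : ℝ, ∀ z ∈ K, ‖monomial z.1 (rootCoeff b θ (k, e k))‖ ≤ C := fun k ↦
    exists_norm_le_of_isCompact hKc (continuous_monomial (rootCoeff_nonneg hθ (he k)))
  choose C hC using hC
  have := Fintype.ofFinite ι
  set D := ∑ k, |C k|
  have hD : ∀ k, ∀ z ∈ K, ‖monomial z.1 (rootCoeff b θ (k, e k))‖ ≤ D := fun k z hz ↦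
    ((hC k z hz).trans (le_abs_self _)).trans
      (Finset.single_le_sum (f := fun k ↦ |C k|) (fun _ _ ↦ abs_nonneg _) (Finset.mem_univ k))
  have hD0 : 0 ≤ D := Finset.sum_nonneg fun _ _ ↦ abs_nonneg _
  -- Write `β = (k, e k) + m δ`, where `(k, e k)` is the lowest positive root over `k`. Since `e k ≤
  -- 1`, `|n| ≤ m + 1`; the factor `1 / q` pays for this shift.
  refine ⟨D / q, q, by positivity, hq0, hq1, fun z hz β hβ ↦ ?_⟩
  obtain ⟨k, n⟩ := β
  have hn : e k ≤ n := hβ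
  obtain ⟨m, hm⟩ := Int.eq_ofNat_of_zero_le (sub_nonneg.mpr hn)
  have hcoeff : rootCoeff b θ (k, n) = rootCoeff b θ (k, e k) + m • deltaCoeff b θ := by
    have hn' : n = e k + m := by linarith
    ext (_ | i)
    · simp [rootCoeff, deltaCoeff, hn']
    · rw [Pi.add_apply, Pi.smul_apply, nsmul_eq_mul]
      simp only [rootCoeff, deltaCoeff, hn']
      ring
  rw [hcoeff, monomial_add_of_nonneg _ (rootCoeff_nonneg hθ (he k)) (nsmul_nonneg hδ m),
    monomial_nsmul, norm_mul, norm_pow]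
  have h1 : ‖monomial z.1 (deltaCoeff b θ)‖ ^ m ≤ q ^ m :=
    pow_le_pow_left₀ (norm_nonneg _) (hq z hz) m
  have h2 : q ^ (m + 1) ≤ q ^ n.natAbs := by
    refine pow_le_pow_of_le_one hq0.le hq1.le ?_
    have : 0 ≤ e k ∧ e k ≤ 1 := by simp only [e]; split_ifs <;> simp
    have hm' : n - e k = m := hm
    omega
  calc _ ≤ D * q ^ m := mul_le_mul (hD k z hz) h1 (by positivity) hD0
    _ = D / q * q ^ (m + 1) := by rw [pow_succ]; field_simp
    _ ≤ D / q * q ^ n.natAbs := by gcongr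

/-- The denominators `1 ∓ u x^β` are bounded away from zero on compact sets. -/
theorem exists_le_norm_one_sub [Finite ι] (hθ : IsHighestRoot b θ) {K : Set (Point (Node b))}
    (hK : K ⊆ region b θ) (hKc : IsCompact K) :
    ∃ c : ℝ, 0 < c ∧ ∀ z ∈ K, ∀ β : AffineRealRoot ι, IsPositive b β → ∀ s : ℤˣ,
      c ≤ ‖1 - z.2 * (((s : ℤ) : ℂ) * monomial z.1 (rootCoeff b θ β))‖ := by
  obtain ⟨C, q, hC0, hq0, hq1, hC⟩ := exists_norm_monomial_le hθ hK hKc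
  obtain ⟨U, hU⟩ := exists_norm_le_of_isCompact hKc (f := fun z : Point (Node b) ↦ z.2)
    continuous_snd
  have hsum := (summable_pow_natAbs (ι := ι) hq0.le hq1).mul_left (|U| * C)
  -- Outside this finite set `|u x^β| < 1/2` uniformly on `K`, so the denominator is at least `1/2`;
  -- for each root inside it compactness gives a positive lower bound.
  have hfin : {β : AffineRealRoot ι | ¬ |U| * C * q ^ β.2.natAbs < 1 / 2}.Finite :=
    hsum.tendsto_cofinite_zero.eventually_lt_const (by norm_num)
  have hev : ∀ β ∈ {β : AffineRealRoot ι | ¬ |U| * C * q ^ β.2.natAbs < 1 / 2},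
      ∀ᶠ c : ℝ in nhdsWithin 0 (Set.Ioi 0), IsPositive b β → ∀ s : ℤˣ, ∀ z ∈ K,
        c ≤ ‖1 - z.2 * (((s : ℤ) : ℂ) * monomial z.1 (rootCoeff b θ β))‖ := by
    intro β _
    by_cases hβ : IsPositive b β
    swap
    · exact Filter.Eventually.of_forall fun c h ↦ absurd h hβ
    have key : ∀ s : ℤˣ, ∀ᶠ c : ℝ in nhdsWithin 0 (Set.Ioi 0), ∀ z ∈ K,
        c ≤ ‖1 - z.2 * (((s : ℤ) : ℂ) * monomial z.1 (rootCoeff b θ β))‖ := by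
      intro s
      have hcont : Continuous fun z : Point (Node b) ↦
          ‖1 - z.2 * (((s : ℤ) : ℂ) * monomial z.1 (rootCoeff b θ β))‖ :=
        (continuous_const.sub (continuous_snd.mul (continuous_const.mul
          (continuous_monomial (rootCoeff_nonneg hθ hβ))))).norm
      obtain ⟨d, hd, hd'⟩ := exists_pos_le_of_isCompact hKc hcont (fun z hz ↦ by
        obtain ⟨h1, h2⟩ := (hK hz).2 β hβ
        rw [norm_pos_iff, sub_ne_zero]
        rcases Int.units_eq_one_or s with h | h
        · rw [h]
          simpa using h1.symm
        · rw [h]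
          simp only [Units.val_neg, Units.val_one, Int.cast_neg, Int.cast_one, neg_mul, one_mul,
            mul_neg]
          exact fun h ↦ h2 (by rw [← neg_neg (z.2 * _), ← h]))
      filter_upwards [Ioo_mem_nhdsGT hd] with c hc z hz
      exact hc.2.le.trans (hd' z hz)
    filter_upwards [key 1, key (-1)] with c h1 h2 _ s
    rcases Int.units_eq_one_or s with rfl | rfl
    · exact h1
    · exact h2
  have hev' := (Filter.eventually_all_finite hfin).mpr hev
  obtain ⟨c, hc1, hc2⟩ := (hev'.and (Ioo_mem_nhdsGT (show (0 : ℝ) < 1 / 2 by norm_num))).exists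
  refine ⟨c, hc2.1, fun z hz β hβ s ↦ ?_⟩
  by_cases hβ' : |U| * C * q ^ β.2.natAbs < 1 / 2
  swap
  · exact hc1 β hβ' hβ s z hz
  have hs : ‖((s : ℤ) : ℂ)‖ = 1 := by
    rcases Int.units_eq_one_or s with rfl | rfl <;> simp
  have h1 : ‖z.2 * (((s : ℤ) : ℂ) * monomial z.1 (rootCoeff b θ β))‖ ≤ 1 / 2 := by
    rw [norm_mul, norm_mul, hs, one_mul]
    refine le_trans ?_ hβ'.le
    rw [mul_assoc]
    exact mul_le_mul ((hU z hz).trans (le_abs_self U)) (hC z hz β hβ) (norm_nonneg _)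
      (abs_nonneg U)
  have h2 := norm_sub_norm_le (1 : ℂ) (z.2 * (((s : ℤ) : ℂ) * monomial z.1 (rootCoeff b θ β)))
  rw [norm_one] at h2
  linarith [hc2.2]

/-- The factor `x / 2` in `J` supplies the geometric decay, and the remaining factor is bounded
because the denominators stay away from zero. -/
theorem exists_norm_J_le [Finite ι] (hθ : IsHighestRoot b θ) {K : Set (Point (Node b))}
    (hK : K ⊆ region b θ) (hKc : IsCompact K) :
    ∃ a : AffineRealRoot ι → ℝ, (∀ β, 0 ≤ a β) ∧ Summable a ∧ ∀ z ∈ K, ∀ β, IsPositive b β →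
      ∀ (s : ℤˣ) (e : ℕ), ‖J (((s : ℤ) : ℂ) * monomial z.1 (rootCoeff b θ β)) z.2 e‖ ≤ a β := by
  obtain ⟨C, q, hC0, hq0, hq1, hC⟩ := exists_norm_monomial_le hθ hK hKc
  obtain ⟨U, hU⟩ := exists_norm_le_of_isCompact hKc (f := fun z : Point (Node b) ↦ z.2)
    continuous_snd
  obtain ⟨c, hc0, hc⟩ := exists_le_norm_one_sub hθ hK hKc
  set D := C / 2 * ((|U| + C) / c + 1) with hDdef
  have hD : 0 ≤ D := by positivity
  refine ⟨fun β ↦ D * q ^ β.2.natAbs, fun β ↦ by positivity,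
    (summable_pow_natAbs hq0.le hq1).mul_left D, fun z hz β hβ s e ↦ ?_⟩
  have hs : ‖((s : ℤ) : ℂ)‖ = 1 := by
    rcases Int.units_eq_one_or s with rfl | rfl <;> simp
  have hden := hc z hz β hβ s
  set x := ((s : ℤ) : ℂ) * monomial z.1 (rootCoeff b θ β) with hx
  have hxn : ‖x‖ ≤ C * q ^ β.2.natAbs := by
    rw [hx, norm_mul, hs, one_mul]
    exact hC z hz β hβ
  have hxC : ‖x‖ ≤ C := hxn.trans (mul_le_of_le_one_right hC0 (pow_le_one₀ hq0.le hq1.le))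
  have h1 : ‖(z.2 - x) / (1 - z.2 * x) - (-1) ^ e‖ ≤ (|U| + C) / c + 1 := by
    refine (norm_sub_le _ _).trans (add_le_add ?_ (by simp))
    rw [norm_div]
    refine div_le_div₀ (by positivity) ((norm_sub_le _ _).trans ?_) hc0 hden
    exact add_le_add ((hU z hz).trans (le_abs_self U)) hxC
  calc ‖J x z.2 e‖ = ‖x‖ / 2 * ‖(z.2 - x) / (1 - z.2 * x) - (-1) ^ e‖ := by
        rw [J, norm_mul, norm_div]; simp
    _ ≤ C * q ^ β.2.natAbs / 2 * ((|U| + C) / c + 1) := by gcongr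
    _ = D * q ^ β.2.natAbs := by rw [hDdef]; ring

theorem stableRegion_subset : stableRegion b θ ⊆ region b θ :=
  fun _ hz ↦ ⟨hz.2.1, fun β _ ↦ hz.2.2 β⟩

variable [P.IsCrystallographic]

/-- Sign changes alter `x^β` only by a sign, and `Ω` excludes both `u x^β = 1` and `u x^β = -1`. -/
theorem signVars_mem_region {i : Node b} {z : Point (Node b)} (hz : z ∈ region b θ) :
    (signVars (dynkin b θ) i z.1, z.2) ∈ region b θ := by
  refine ⟨?_, fun β hβ ↦ ?_⟩
  · obtain ⟨s, hs⟩ := exists_monomial_signVars (dynkin b θ) i z.1 (deltaCoeff b θ)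
    rw [hs, norm_mul]
    rcases Int.units_eq_one_or s with rfl | rfl <;> simpa using hz.1
  · obtain ⟨s, hs⟩ := exists_monomial_signVars (dynkin b θ) i z.1 (rootCoeff b θ β)
    obtain ⟨h1, h2⟩ := hz.2 β hβ
    rw [hs]
    rcases Int.units_eq_one_or s with rfl | rfl
    · simpa using ⟨h1, h2⟩
    · simp only [Units.val_neg, Units.val_one, Int.cast_neg, Int.cast_one, neg_mul, one_mul,
        mul_neg, neg_inj, Ne]
      exact ⟨fun h ↦ h2 (neg_eq_iff_eq_neg.mp h), h1⟩

theorem signVars_mem_stableRegion {i : Node b} {z : Point (Node b)} (hz : z ∈ stableRegion b θ) :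
    (signVars (dynkin b θ) i z.1, z.2) ∈ stableRegion b θ := by
  refine ⟨fun j ↦ ?_, (signVars_mem_region (stableRegion_subset hz)).1, fun β ↦ ?_⟩
  · simp only [signVars]
    split_ifs
    · exact neg_ne_zero.mpr (hz.1 j)
    · exact hz.1 j
  · obtain ⟨s, hs⟩ := exists_monomial_signVars (dynkin b θ) i z.1 (rootCoeff b θ β)
    obtain ⟨h1, h2⟩ := hz.2.2 β
    rw [hs]
    rcases Int.units_eq_one_or s with rfl | rfl
    · simpa using ⟨h1, h2⟩
    · simp only [Units.val_neg, Units.val_one, Int.cast_neg, Int.cast_one, neg_mul, one_mul,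
        mul_neg, neg_inj, Ne]
      exact ⟨fun h ↦ h2 (neg_eq_iff_eq_neg.mp h), h1⟩

variable [Finite ι]

/-- `σ_i` fixes `δ` and permutes the real roots, positive and negative together; hence the
conditions for all real roots. -/
theorem reflectVars_mem_stableRegion (hsl : (affineCartan b θ).IsSimplyLaced) (i : Node b)
    {z : Point (Node b)} (hz : z ∈ stableRegion b θ) :
    (reflectVars (dynkin b θ) i z.1, z.2) ∈ stableRegion b θ := by
  refine ⟨fun j ↦ ?_, ?_, fun β ↦ ?_⟩
  · simp only [reflectVars]
    split_ifs
    · exact inv_ne_zero (hz.1 j)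
    · exact mul_ne_zero (hz.1 i) (hz.1 j)
    · exact hz.1 j
  · rw [monomial_reflectVars_deltaCoeff hsl i (hz.1 i)]
    exact hz.2.1
  · rw [monomial_reflectVars_rootCoeff hsl i (hz.1 i)]
    exact hz.2.2 _

variable [P.IsReduced]

/-- The majorant of `1|w` is `∏ 2 a_β` over its inversion set. Distinct elements have distinct
inversion sets, so these form a subfamily of the expansion of the convergent product `∏ (1 + 2
a_β)`. -/
theorem exists_hasValue_of_isCompact (hθ : IsHighestRoot b θ)
    (hsl : (affineCartan b θ).IsSimplyLaced) {K : Set (Point (Node b))}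
    (hK : K ⊆ region b θ) (hKc : IsCompact K) :
    ∃ a : affineWeylGroup P → ℝ, Summable a ∧ ∀ w, ∀ z ∈ K,
      ∃ v, HasValue (slash b θ w 1) z v ∧ ‖v‖ ≤ a w := by
  obtain ⟨a, ha0, ha, hJ⟩ := exists_norm_J_le hθ hK hKc
  choose S hS hsum using exists_isInversionSet_isJSum (P := P) (b := b) (θ := θ) hsl hθ
  have hSinj : Function.Injective S := fun v w h ↦
    IsInversionSet.unique hsl hθ (hS v) (h ▸ hS w)
  let E := affineWeylGroupEquiv hsl hθ
  refine ⟨fun w ↦ ∏ β ∈ S (E.symm w), 2 * a β, ?_, fun w z hz ↦ ?_⟩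
  · exact (summable_finsetProd_of_summable_nonneg (fun β ↦ mul_nonneg zero_le_two (ha0 β))
      (ha.mul_left 2)).comp_injective (hSinj.comp E.symm.injective)
  · obtain ⟨v, rfl⟩ := E.surjective w
    simp only [MulEquiv.symm_apply_apply]
    have h : slash b θ (E v) 1 = (slashHom (dynkin b θ) v).unop 1 := by
      obtain ⟨l, rfl⟩ := (diagramSystem b θ).wordProd_surjective v
      rw [show E ((diagramSystem b θ).wordProd l) = wordProd b θ l from
        toAffineWeylGroup_wordProd hsl l, slash_wordProd hsl hθ]
      exact (slashHom_wordProd _ _ _).symm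
    rw [h]
    exact (hsum v).exists_hasValue hθ (fun β hβ ↦ ((hS v β).mp hβ).1) (hK hz)
      fun β hβ s e ↦ hJ z hz β ((hS v β).mp hβ).1 s e

theorem hasValue_term (hθ : IsHighestRoot b θ) (hsl : (affineCartan b θ).IsSimplyLaced)
    (w : affineWeylGroup P) {z : Point (Node b)} (hz : z ∈ region b θ) :
    HasValue (slash b θ w 1) z (term b θ w z) := by
  obtain ⟨_, _, h⟩ := exists_hasValue_of_isCompact (P := P) hθ hsl
    (Set.singleton_subset_iff.mpr hz) isCompact_singleton
  obtain ⟨v, hv, _⟩ := h w z rfl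
  exact hv.isRegularAt.hasValue

theorem exists_summable_norm_term_le (hθ : IsHighestRoot b θ)
    (hsl : (affineCartan b θ).IsSimplyLaced) {K : Set (Point (Node b))}
    (hK : K ⊆ region b θ) (hKc : IsCompact K) :
    ∃ a : affineWeylGroup P → ℝ, Summable a ∧ ∀ w, ∀ z ∈ K, ‖term b θ w z‖ ≤ a w := by
  obtain ⟨a, ha, h⟩ := exists_hasValue_of_isCompact (P := P) hθ hsl hK hKc
  refine ⟨a, ha, fun w z hz ↦ ?_⟩
  obtain ⟨v, hv, hv'⟩ := h w z hz
  rwa [term, hv.value_eq]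

theorem summable_norm_term (hθ : IsHighestRoot b θ) (hsl : (affineCartan b θ).IsSimplyLaced)
    {z : Point (Node b)} (hz : z ∈ region b θ) : Summable fun w ↦ ‖term b θ w z‖ := by
  obtain ⟨a, ha, h⟩ := exists_summable_norm_term_le (P := P) hθ hsl
    (Set.singleton_subset_iff.mpr hz) isCompact_singleton
  exact Summable.of_nonneg_of_le (fun _ ↦ norm_nonneg _) (fun w ↦ h w z rfl) ha

/-- The average is invariant under the simple reflections. -/
theorem slashFun_ZW (hθ : IsHighestRoot b θ) (hsl : (affineCartan b θ).IsSimplyLaced)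
    (i : Node b) {z : Point (Node b)} (hz : z ∈ region b θ) (hi : z.1 i ≠ 0)
    (hz' : (reflectVars (dynkin b θ) i z.1, z.2) ∈ region b θ) :
    slashFun (dynkin b θ) i (ZW b θ) z = ZW b θ z := by
  have hz'' := signVars_mem_region (i := i) hz'
  have hu : 1 - z.2 * z.1 i ≠ 0 := by
    have := (hz.2 _ (isPositive_simpleRoot hθ i)).1
    rw [monomial_simpleRoot] at this
    exact sub_ne_zero.mpr this.symm
  have hterm : ∀ w : affineWeylGroup P, term b θ (w * simpleReflection b θ i) z =
      term b θ w (reflectVars (dynkin b θ) i z.1, z.2) * J (z.1 i) z.2 0 +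
      term b θ w (signVars (dynkin b θ) i (reflectVars (dynkin b θ) i z.1), z.2) *
        J (z.1 i) z.2 1 := by
    intro w
    rw [term, slash_mul hsl hθ, slash_simpleReflection hsl hθ]
    exact ((hasValue_term hθ hsl w hz').slashSimple _ i hi hu (hasValue_term hθ hsl w hz'')).value_eq
  -- Absolute convergence at both shifted points allows the two series to be added termwise; right
  -- multiplication by `σ_i` then permutes the summands.
  rw [slashFun, ZW, ZW, ← tsum_mul_right, ZW, ← tsum_mul_right,
    ← Summable.tsum_add ((summable_norm_term hθ hsl hz').of_norm.mul_right _)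
      ((summable_norm_term hθ hsl hz'').of_norm.mul_right _),
    ← (Equiv.mulRight (simpleReflection b θ i)).tsum_eq fun w ↦ term b θ w z]
  exact tsum_congr fun w ↦ (hterm w).symm

/-- The last letter of the word acts last, so it is peeled off first. The region is stable under
`σ_i` and `ε_i`, so the shorter word can be evaluated at both shifted points. -/
theorem slashFunWord_ZW (hθ : IsHighestRoot b θ) (hsl : (affineCartan b θ).IsSimplyLaced)
    (l : List (Node b)) {z : Point (Node b)} (hz : z ∈ stableRegion b θ) :
    slashFunWord (dynkin b θ) l (ZW b θ) z = ZW b θ z := by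
  induction l using List.reverseRecOn generalizing z with
  | nil => rfl
  | append_singleton l i ih =>
    have h1 := reflectVars_mem_stableRegion hsl i hz
    rw [slashFunWord, List.foldl_append, List.foldl_cons, List.foldl_nil]
    change slashFun (dynkin b θ) i (slashFunWord (dynkin b θ) l (ZW b θ)) z = _
    rw [slashFun, ih h1, ih (signVars_mem_stableRegion h1)]
    exact slashFun_ZW hθ hsl i (stableRegion_subset hz) (hz.1 i) (stableRegion_subset h1)

end Bounds

end ChintaGunnells

end

open ChintaGunnells in
theorem mainTheorem10 {ι M N : Type*} [Finite ι]
    [AddCommGroup M] [Module ℝ M] [AddCommGroup N] [Module ℝ N]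
    (P : RootPairing ι ℝ M N) [P.IsRootSystem] [P.IsCrystallographic] [P.IsReduced]
    [P.IsIrreducible] (b : P.Base) (θ : ι) (hθ : IsHighestRoot b θ)
    (hsl : (affineCartan b θ).IsSimplyLaced) :
    -- the action of the simple reflections extends to a well-defined right action of the group
    (∀ w : affineWeylGroup P, ∃ l, wordProd b θ l = w) ∧
    (∀ l f, slash b θ (wordProd b θ l) f = slashWord (dynkin b θ) l f) ∧
    (∀ f, slash b θ 1 f = f) ∧
    (∀ i f, slash b θ (simpleReflection b θ i) f = slashSimple (dynkin b θ) i f) ∧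
    (∀ w w' f, slash b θ (w * w') f = slash b θ w' (slash b θ w f)) ∧
    -- the terms of the series have no poles in the region
    (∀ w, ∀ z ∈ region b θ, IsRegularAt (slash b θ w 1) z) ∧
    -- absolute convergence, and uniform convergence on compact subsets
    (∀ z ∈ region b θ, Summable fun w ↦ ‖term b θ w z‖) ∧
    (∀ K ⊆ region b θ, IsCompact K →
      HasSumUniformlyOn (term b θ) (ZW b θ) K ∧
      SummableUniformlyOn (fun w z ↦ ‖term b θ w z‖) K) ∧
    -- invariance under a simple reflection, wherever both sides are defined
    (∀ i, ∀ z ∈ region b θ, z.1 i ≠ 0 →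
      (reflectVars (dynkin b θ) i z.1, z.2) ∈ region b θ →
      slashFun (dynkin b θ) i (ZW b θ) z = ZW b θ z) ∧
    -- invariance under every element of the group, given by an arbitrary expression
    (∀ (w : affineWeylGroup P) (l : List (Node b)), wordProd b θ l = w →
      ∀ z ∈ stableRegion b θ, slashFunWord (dynkin b θ) l (ZW b θ) z = ZW b θ z) := by
  refine ⟨exists_wordProd_eq hsl hθ, slash_wordProd hsl hθ, slash_wordProd hsl hθ [],
    slash_simpleReflection hsl hθ, slash_mul hsl hθ,
    fun w z hz ↦ (hasValue_term hθ hsl w hz).isRegularAt,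
    fun z hz ↦ summable_norm_term hθ hsl hz, fun K hK hKc ↦ ?_,
    fun i z hz hi hz' ↦ slashFun_ZW hθ hsl i hz hi hz',
    fun _ l _ z hz ↦ slashFunWord_ZW hθ hsl l hz⟩
  obtain ⟨a, ha, h⟩ := exists_summable_norm_term_le (P := P) hθ hsl hK hKc
  -- The same majorant serves in the Weierstrass test for the series and for the series of norms.
  exact ⟨HasSumUniformlyOn.of_norm_le_summable ha h,
    (HasSumUniformlyOn.of_norm_le_summable ha fun w z hz ↦ by
      simpa using h w z hz).summableUniformlyOn⟩
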